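/- **Setting.** Let $C\subset\mathbb{R}^n$, $n\ge 1$ (or, more generally, $C$ in a nonzero finite-dimensional real inner product space) be a closed convex cone that is pointed ($C\cap(-C)=\{0\}$) and has nonempty interior. Write $x\le y$ if $y-x\in C$, and $\operatorname{Funk}(x,y)=\log\inf\{\alpha>0 : x\le \alpha y\}\in\mathbb{R}\cup\{+\infty\}$ for $x,y\in C\setminus\{0\}$ (this is finite for $x,y\in\operatorname{int}C$). Let $\mathcal{A},\mathcal{B}$ be nonempty compact spaces and let $(T_{ab})_{(a,b)\in\mathcal{A}\times\mathcal{B}}$ be self-maps of $\operatorname{int} C$ that are order-preserving ($x\le y\Rightarrow T_{ab}(x)\le T_{ab}(y)$) and positively homogeneous ($T_{ab}(\lambda x)=\lambda T_{ab}(x)$ for $\lambda>0$). Assume that the $T_{ab}$ extend to maps $C\to C$, still denoted $T_{ab}$, such that $(a,b,x)\mapsto T_{ab}(x)$ is continuous on $\mathcal{A}\times\mathcal{B}\times C$. *The conical escape rate game.* From an initial state $x_0\in\operatorname{int}C$, at each turn $k\ge1$ player Min chooses $a_k\in\mathcal{A}$, then player Max, knowing $a_k$, chooses $b_k\in\mathcal{B}$,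 and the state becomes $x_k=T_{a_kb_k}(x_{k-1})$; strategies may depend on the whole history of states and actions. With $J_k=\operatorname{Funk}(x_k,x_0)$, Min wants to minimize and Max to maximize $J_\infty=\limsup_k J_k/k$. The game has value $\rho$ if for every $\varepsilon>0$ Min has a strategy ensuring $J_\infty\le\rho+\varepsilon$ against all strategies of Max, and Max has a strategy ensuring $J_\infty\ge\rho-\varepsilon$ against all strategies of Min. It has uniform value $\rho$ if for every $\varepsilon>0$ there are $N$ and strategies of Min and Max which ensure $J_k/k\le\rho+\varepsilon$ and $J_k/k\ge\rho-\varepsilon$, respectively, for all $k\ge N$ and against all strategies of the opponent. *The normalized Shapley operator.* Fix $e^*$ in the interior of the dual cone $C^*=\{y : \langle x,y\rangle\ge 0\ \forall x\in C\}$ and let $\Delta=\{x\in C : \langle x,e^*\rangle=1\}$. Let $\operatorname{CLip}_1(\Delta)$ be the set of continuous functions $v:\Delta\to\mathbb{R}$ such that $v(x)-v(y)\le\operatorname{Funk}(x,y)$ whenever $x,y\in\Delta$ and $\operatorname{Funk}(x,y)<\infty$. For $v:\Delta\to\mathbb{R}\cup\{-\infty\}$ and $x\in\Delta$ put $$[Fv](x)=\inf_{a\in\mathcal{A}}\sup_{b\in\mathcal{B}}\Big\{\log\langle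 T_{ab}(x),e^*\rangle+v\Big(\frac{T_{ab}(x)}{\langle T_{ab}(x),e^*\rangle}\Big)\Big\},$$ where the term in braces is $-\infty$ if $T_{ab}(x)=0$ (which can happen only for $x$ in the boundary of $C$). Let $\delta(f,g)=\sup_{x\in\Delta}(f(x)-g(x))$. **Theorem.** There is $\rho\in\mathbb{R}$ which, for every initial state $x_0\in\operatorname{int}C$, is the unique uniform value and the unique value of the conical escape rate game, and $$\rho=\lim_{k\to\infty}\frac{\delta(F^k(0),0)}{k} =\inf_{v\in\operatorname{CLip}_1(\Delta)}\ \max_{x\in\Delta}\big\{[Fv](x)-v(x)\big\} =\inf\{\lambda\in\mathbb{R} : \exists v\in\operatorname{CLip}_1(\Delta),\ Fv\le\lambda+v\},$$ where for each $v\in\operatorname{CLip}_1(\Delta)$ the maximum over $\Delta$ is attained and is a real number. No almost-isometry assumption on the maps $T_{ab}$ is made. -/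

import Mathlib

open Set Filter Topology

noncomputable section

namespace EscapeRate

/-! ## The escape rate game on a state space `X` with payoff function `d` -/

section Game

variable {X A B : Type*}

/-- A strategy of Min: the history `(x₀, a₁, b₁), …, (x_{k-1}, a_k, b_k)` and the current
state `x_k` determine the next action of Min. -/
abbrev MinStrategy (X A B : Type*) := List (X × A × B) → X → A

/-- A strategy of Max: the history, the current state and the action that Min has just
chosen determine the next action of Max. -/
abbrev MaxStrategy (X A B : Type*) := List (X × A × B) → X → A → B

/-- The history and the current state after `k` turns, when the initial state is `x₀` and the
players use the strategies `σ` and `τ`. -/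
def play (T : A → B → X → X) (x₀ : X) (σ : MinStrategy X A B) (τ : MaxStrategy X A B) :
    ℕ → List (X × A × B) × X
  | 0 => ([], x₀)
  | k + 1 =>
    let p := play T x₀ σ τ k
    let a := σ p.1 p.2
    let b := τ p.1 p.2 a
    (p.1 ++ [(p.2, a, b)], T a b p.2)

/-- The payoff `J_k(σ, τ) = d(x_k, x₀)` of the game in horizon `k`. -/
def payoff (d : X → X → ℝ) (T : A → B → X → X) (x₀ : X)
    (σ : MinStrategy X A B) (τ : MaxStrategy X A B) (k : ℕ) : ℝ :=
  d (play T x₀ σ τ k).2 x₀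

/-- The payoff `J_∞(σ, τ) = limsup_k J_k(σ, τ) / k` of the escape rate game. -/
def escapeRate (d : X → X → ℝ) (T : A → B → X → X) (x₀ : X)
    (σ : MinStrategy X A B) (τ : MaxStrategy X A B) : EReal :=
  limsup (fun k : ℕ => ((payoff d T x₀ σ τ k / k : ℝ) : EReal)) atTop

/-- `ρ` is the value of the escape rate game: for every `ε > 0` both players
have `ε`-optimal strategies. -/
def IsValue (d : X → X → ℝ) (T : A → B → X → X) (x₀ : X) (ρ : ℝ) : Prop :=
  ∀ ε : ℝ, 0 < ε → ∃ (σ' : MinStrategy X A B) (τ' : MaxStrategy X A B),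
    (∀ τ : MaxStrategy X A B, escapeRate d T x₀ σ' τ ≤ ((ρ + ε : ℝ) : EReal)) ∧
    (∀ σ : MinStrategy X A B, ((ρ - ε : ℝ) : EReal) ≤ escapeRate d T x₀ σ τ')

/-- `ρ` is the uniform value of the escape rate game (in the sense of Mertens and Neyman). -/
def IsUniformValue (d : X → X → ℝ) (T : A → B → X → X) (x₀ : X) (ρ : ℝ) : Prop :=
  ∀ ε : ℝ, 0 < ε → ∃ (σ' : MinStrategy X A B) (τ' : MaxStrategy X A B) (N : ℕ),
    ∀ k : ℕ, N ≤ k →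
      (∀ τ : MaxStrategy X A B, payoff d T x₀ σ' τ k / k ≤ ρ + ε) ∧
      (∀ σ : MinStrategy X A B, ρ - ε ≤ payoff d T x₀ σ τ' k / k)

end Game

/-! ## The conical setting -/

section Cone

variable {E : Type*} [NormedAddCommGroup E] [InnerProductSpace ℝ E]

/-- The set of `α > 0` such that `x ≤ α y` in the order induced by `C`. -/
def funkSet (C : ProperCone ℝ E) (x y : E) : Set ℝ :=
  {α : ℝ | 0 < α ∧ α • y - x ∈ C}

/-- The Funk hemi-metric `Funk(x, y) = log inf {α > 0 | x ≤ α y}`. For nonzero `x, y` in a closed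
pointed cone `C` it is finite exactly when `funkSet C x y` is nonempty, in particular for `y` in
the interior of `C`; the value of this function is only used in that case. -/
def funk (C : ProperCone ℝ E) (x y : E) : ℝ := Real.log (sInf (funkSet C x y))

/-- The cross section `Δ = {x ∈ C | ⟨x, e⟩ = 1}` of `C`. -/
def crossSection (C : ProperCone ℝ E) (e : E) : Set E :=
  {x : E | x ∈ C ∧ inner ℝ x e = 1}

/-- The set `CLip₁(Δ)` of continuous functions `v` on `Δ` such that `v x - v y ≤ Funk(x, y)` as
soon as `Funk(x, y) < ∞`. (Only the values of `v` on `Δ` matter.) -/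
def CLip (C : ProperCone ℝ E) (e : E) : Set (E → ℝ) :=
  {v : E → ℝ | ContinuousOn v (crossSection C e) ∧
    ∀ x ∈ crossSection C e, ∀ y ∈ crossSection C e,
      (funkSet C x y).Nonempty → v x - v y ≤ funk C x y}

variable {A B : Type*}

/-- The normalized Shapley operator
`F v (x) = inf_a sup_b (log ⟨T_ab x, e⟩ + v (T_ab x / ⟨T_ab x, e⟩))`, with the convention
`log 0 = -∞`: when `T_ab x = 0`, which may happen at points `x` of the boundary of the cone,
the term between parentheses is `-∞` (in `EReal` one has `⊥ + y = ⊥` for all `y`). -/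
def shapley (T : A → B → E → E) (e : E) (v : E → EReal) (x : E) : EReal :=
  ⨅ a : A, ⨆ b : B,
    ENNReal.log (ENNReal.ofReal (inner ℝ (T a b x) e)) +
      v ((inner ℝ (T a b x) e)⁻¹ • T a b x)

/-- The hemi-metric `δ(f, g) = max_{x ∈ Δ} (f x - g x)`. -/
def delta (C : ProperCone ℝ E) (e : E) (f g : E → EReal) : EReal :=
  ⨆ x ∈ crossSection C e, (f x - g x)

end Cone

end EscapeRate

end

open EscapeRate

/-! Exponentiation turns `v` on Δ into V(x) = ⟨x,e⟩ exp v(x/⟨x,e⟩) on C. Under it `CLip` becomes the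
class of continuous, order-preserving, homogeneous functions that are positive and finite off 0, and
F becomes ΦV(x) = inf_a sup_b V(T_ab x). Values in [0,∞] absorb the convention log 0 = -∞. On the
interior Funk(·, x₀) is log⟨·,e⟩ up to a bounded error (`exists_funk_bounds`), so the game is about
the growth of h = ⟨·,e⟩ along the play. The suprema g_k of Φ^k h over Δ are submultiplicative and
squeezed between geometric sequences, so Fekete's lemma gives ρ = lim log g_k / k = inf log g_k / k
(`exists_growthRate`).

Min, l > ρ: some g_k < e^{kl}. The minimum of e^{-jl} Φ^j h over j < k satisfies ΦV ≤ e^l V, since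
the shift by one index wraps around at k. Replacing Φ by max(Φ, η·) with small η keeps V positive
(`exists_subsolution`). A near-minimizing stationary strategy for V bounds the growth, and log V
shows that the infimum over `CLip` is at most ρ. Conversely, iterating any subsolution bounds g_k,
hence ρ (`le_of_shapley_le`).

Max, l < ρ: for l < l' < ρ, the maximum U_n of e^{-jl'} Φ^j h over j ≤ n satisfies U_n ≤ max(h,
e^{-l'} ΦU_n), and its supremum over Δ tends to infinity. After normalization the obstacle h
disappears in a pointwise ultralimit H, which a Harnack inequality keeps positive on the interior.
At an interior state finitely many actions b suffice up to the factor e^{l'-l}, so the limit passes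
through the supremum (`exists_superharmonic`). No continuity of H is needed, which is why no
almost-isometry assumption enters. -/

noncomputable section

namespace EscapeRate

/-! ### Geometry of the cone and its cross section -/

section ConeGeometry

variable {E : Type*} [NormedAddCommGroup E] [InnerProductSpace ℝ E] {C : ProperCone ℝ E} {e : E}

lemma cone_smul_mem {x : E} (hx : x ∈ C) {c : ℝ} (hc : 0 ≤ c) : c • x ∈ C :=
  C.smul_mem hx hc

lemma cone_mem_of_sub_mem {x y : E} (hx : x ∈ C) (hxy : y - x ∈ C) : y ∈ C := by
  simpa using add_mem hxy hx

lemma inner_nonneg_of_mem [FiniteDimensional ℝ E]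
    (he : e ∈ interior (ProperCone.innerDual (C : Set E) : Set E))
    {x : E} (hx : x ∈ C) : 0 ≤ inner ℝ x e :=
  (interior_subset he : e ∈ ProperCone.innerDual (C : Set E)) hx

/-- A point of the interior of the dual cone controls the norm on the cone. -/
lemma exists_norm_le_inner [FiniteDimensional ℝ E]
    (he : e ∈ interior (ProperCone.innerDual (C : Set E) : Set E)) :
    ∃ K : ℝ, 0 < K ∧ ∀ x ∈ C, ‖x‖ ≤ K * inner ℝ x e := by
  obtain ⟨r, hr, hball⟩ := Metric.mem_nhds_iff.1 (mem_interior_iff_mem_nhds.1 he)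
  refine ⟨2 / r, by positivity, fun x hx => ?_⟩
  rcases eq_or_ne x 0 with rfl | hx0
  · simp
  have hn : 0 < ‖x‖ := norm_pos_iff.2 hx0
  have hmem : e - (r / 2 / ‖x‖) • x ∈ Metric.ball e r := by
    rw [mem_ball_iff_norm, sub_sub_cancel_left, norm_neg, norm_smul, Real.norm_of_nonneg
      (by positivity), div_mul_cancel₀ _ hn.ne']
    linarith
  have h : 0 ≤ inner ℝ x (e - (r / 2 / ‖x‖) • x) := hball hmem hx
  rw [inner_sub_right, inner_smul_right, real_inner_self_eq_norm_sq] at h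
  have h2 : r / 2 / ‖x‖ * ‖x‖ ^ 2 = r / 2 * ‖x‖ := by field_simp
  rw [h2] at h
  rw [div_mul_eq_mul_div, le_div_iff₀ hr]
  linarith

lemma inner_pos_of_mem [FiniteDimensional ℝ E]
    (he : e ∈ interior (ProperCone.innerDual (C : Set E) : Set E))
    {x : E} (hx : x ∈ C) (hx0 : x ≠ 0) : 0 < inner ℝ x e := by
  obtain ⟨K, hK, h⟩ := exists_norm_le_inner he
  have := (norm_pos_iff.2 hx0).trans_le (h x hx)
  exact pos_of_mul_pos_right this hK.le

/-- Were 0 interior, C would contain both x and -x for some small x ≠ 0, whereas ⟨·,e⟩ is positive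
at nonzero points of C. -/
lemma ne_zero_of_mem_interior [Nontrivial E] [FiniteDimensional ℝ E]
    (he : e ∈ interior (ProperCone.innerDual (C : Set E) : Set E))
    {u : E} (hu : u ∈ interior (C : Set E)) : u ≠ 0 := by
  rintro rfl
  have h1 : (C : Set E) ∈ 𝓝 (0 : E) := mem_interior_iff_mem_nhds.1 hu
  have h2 : Neg.neg ⁻¹' (C : Set E) ∈ 𝓝 (0 : E) :=
    continuous_neg.continuousAt.preimage_mem_nhds (by simpa using h1)
  have : (𝓝[≠] (0 : E)).NeBot := Module.punctured_nhds_neBot ℝ E 0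
  obtain ⟨x, ⟨hx, hx'⟩, hx0⟩ : (((C : Set E) ∩ Neg.neg ⁻¹' (C : Set E)) ∩ {0}ᶜ).Nonempty :=
    nonempty_of_mem (inter_mem (mem_nhdsWithin_of_mem_nhds (inter_mem h1 h2)) self_mem_nhdsWithin)
  have p1 := inner_pos_of_mem he (C := C) hx hx0
  have p2 := inner_nonneg_of_mem he (C := C) (x := -x) hx'
  rw [inner_neg_left] at p2
  linarith

lemma inner_pos_of_mem_interior [Nontrivial E] [FiniteDimensional ℝ E]
    (he : e ∈ interior (ProperCone.innerDual (C : Set E) : Set E))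
    {u : E} (hu : u ∈ interior (C : Set E)) : 0 < inner ℝ u e :=
  inner_pos_of_mem he (interior_subset hu) (ne_zero_of_mem_interior he hu)

lemma add_mem_interior {x u : E} (hx : x ∈ C) (hu : u ∈ interior (C : Set E)) :
    x + u ∈ interior (C : Set E) := by
  refine interior_maximal ?_ ((Homeomorph.addLeft x).isOpenMap _ isOpen_interior)
    (mem_image_of_mem (Homeomorph.addLeft x) hu)
  rintro _ ⟨z, hz, rfl⟩
  exact add_mem hx (interior_subset hz : z ∈ C)

lemma smul_mem_interior {u : E} (hu : u ∈ interior (C : Set E)) {c : ℝ} (hc : 0 < c) :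
    c • u ∈ interior (C : Set E) := by
  refine interior_maximal ?_ ((Homeomorph.smulOfNeZero c hc.ne').isOpenMap _ isOpen_interior)
    (mem_image_of_mem (Homeomorph.smulOfNeZero c hc.ne') hu)
  rintro _ ⟨z, hz, rfl⟩
  exact cone_smul_mem (interior_subset hz : z ∈ C) hc.le

/-- An interior point is an order unit of the cone. -/
lemma exists_dominates [FiniteDimensional ℝ E]
    (he : e ∈ interior (ProperCone.innerDual (C : Set E) : Set E))
    {u : E} (hu : u ∈ interior (C : Set E)) :
    ∃ K : ℝ, 0 < K ∧ ∀ x ∈ C, (K * inner ℝ x e) • u - x ∈ C := by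
  obtain ⟨K, hK, hnorm⟩ := exists_norm_le_inner he
  obtain ⟨r, hr, hball⟩ := Metric.mem_nhds_iff.1 (mem_interior_iff_mem_nhds.1 hu)
  refine ⟨2 / r * K, by positivity, fun x hx => ?_⟩
  rcases eq_or_ne x 0 with rfl | hx0
  · simp
  have hn : 0 < ‖x‖ := norm_pos_iff.2 hx0
  have hmem : u - (r / 2 / ‖x‖) • x ∈ Metric.ball u r := by
    rw [mem_ball_iff_norm, sub_sub_cancel_left, norm_neg, norm_smul, Real.norm_of_nonneg
      (by positivity), div_mul_cancel₀ _ hn.ne']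
    linarith
  -- The target is the sum of (2‖x‖/r) u - x, a multiple of a point of the ball around u, and of a
  -- nonnegative multiple of u.
  have h1 : (2 * ‖x‖ / r) • (u - (r / 2 / ‖x‖) • x) ∈ C :=
    cone_smul_mem (hball hmem) (by positivity)
  have h2 : (2 / r * (K * inner ℝ x e - ‖x‖)) • u ∈ C :=
    cone_smul_mem (interior_subset hu : u ∈ C)
      (mul_nonneg (by positivity) (sub_nonneg.2 (hnorm x hx)))
  convert add_mem h1 h2 using 1
  rw [smul_sub, smul_smul, show 2 * ‖x‖ / r * (r / 2 / ‖x‖) = 1 by field_simp, one_smul]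
  module

lemma isCompact_crossSection [FiniteDimensional ℝ E]
    (he : e ∈ interior (ProperCone.innerDual (C : Set E) : Set E)) :
    IsCompact (crossSection C e) := by
  have : ProperSpace E := FiniteDimensional.proper ℝ E
  obtain ⟨K, hK, hnorm⟩ := exists_norm_le_inner he
  refine Metric.isCompact_of_isClosed_isBounded ?_ ?_
  · have h : IsClosed {x : E | inner ℝ x e = 1} :=
      isClosed_eq (continuous_id.inner continuous_const) continuous_const
    exact C.isClosed.inter h
  · refine (Metric.isBounded_closedBall (x := (0 : E)) (r := K)).subset fun x hx => ?_
    rw [mem_closedBall_zero_iff]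
    simpa [hx.2] using hnorm x hx.1

lemma inv_inner_smul_mem_crossSection {x : E} (hx : x ∈ C) (hpos : 0 < inner ℝ x e) :
    (inner ℝ x e)⁻¹ • x ∈ crossSection C e :=
  ⟨cone_smul_mem hx (inv_nonneg.2 hpos.le), by
    rw [real_inner_smul_left, inv_mul_cancel₀ hpos.ne']⟩

end ConeGeometry

/-! ### The Shapley operator in multiplicative form, and conic functions -/

section ShapleyOperator

variable {E A B : Type*} {T : A → B → E → E}

/-- The Shapley operator on positively homogeneous functions, whose logarithmic form
is `shapley`. -/
def conicShapley (T : A → B → E → E) (V : E → ENNReal) (x : E) : ENNReal :=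
  ⨅ a : A, ⨆ b : B, V (T a b x)

lemma conicShapley_const_mul {c : ENNReal} (hc0 : c ≠ 0) (hc : c ≠ ⊤) (V : E → ENNReal) (x : E) :
    conicShapley T (fun y => c * V y) x = c * conicShapley T V x := by
  simp only [conicShapley, ENNReal.mul_iInf_of_ne hc0 hc, ENNReal.mul_iSup]

lemma conicShapley_iterate_const_mul {c : ENNReal} (hc0 : c ≠ 0) (hc : c ≠ ⊤) (V : E → ENNReal)
    (k : ℕ) : (conicShapley T)^[k] (fun y => c * V y) =
      fun y => c * (conicShapley T)^[k] V y := by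
  induction k with
  | zero => rfl
  | succ k ih =>
    simp only [Function.iterate_succ_apply', ih]
    exact funext fun x => conicShapley_const_mul hc0 hc _ x

end ShapleyOperator

section ConicFunctions

variable {E : Type*} [NormedAddCommGroup E] [InnerProductSpace ℝ E] {C : ProperCone ℝ E} {e : E}
  {A B : Type*} {T : A → B → E → E} {V W : E → ENNReal}

/-- The linear form `⟨·, e⟩`, as a function with values in `[0, ∞]`. -/
def height (e x : E) : ENNReal := ENNReal.ofReal (inner ℝ x e)

/-- Order-preserving and positively homogeneous functions on a cone. -/
structure IsConicFun (C : ProperCone ℝ E) (V : E → ENNReal) : Prop where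
  zero : V 0 = 0
  mono : ∀ x ∈ C, ∀ y, y - x ∈ C → V x ≤ V y
  smul : ∀ x ∈ C, ∀ c : ℝ, 0 < c → V (c • x) = ENNReal.ofReal c * V x

/-- A family of order-preserving and positively homogeneous self-maps of a cone that preserve
its interior. -/
structure IsConicFamily (C : ProperCone ℝ E) (T : A → B → E → E) : Prop where
  mem : ∀ a b, ∀ x ∈ C, T a b x ∈ C
  mem_interior : ∀ a b, ∀ x ∈ interior (C : Set E), T a b x ∈ interior (C : Set E)
  mono : ∀ a b, ∀ x ∈ C, ∀ y, y - x ∈ C → T a b y - T a b x ∈ C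
  smul : ∀ a b, ∀ x ∈ C, ∀ c : ℝ, 0 < c → T a b (c • x) = c • T a b x

lemma IsConicFamily.map_zero (hT : IsConicFamily C T) (a : A) (b : B) : T a b 0 = 0 := by
  have h := hT.smul a b 0 C.zero_mem 2 two_pos
  rw [smul_zero, two_smul] at h
  simpa using h

lemma isConicFun_height [FiniteDimensional ℝ E]
    (he : e ∈ interior (ProperCone.innerDual (C : Set E) : Set E)) :
    IsConicFun C (height e) where
  zero := by simp [height]
  mono x _ y hxy := by
    have := inner_nonneg_of_mem he hxy
    rw [inner_sub_left] at this
    exact ENNReal.ofReal_le_ofReal (by linarith)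
  smul x _ c hc := by
    rw [height, real_inner_smul_left, ENNReal.ofReal_mul hc.le, height]

lemma continuous_height : Continuous (height e) :=
  ENNReal.continuous_ofReal.comp (continuous_id.inner continuous_const)

lemma height_ne_top (x : E) : height e x ≠ ⊤ := ENNReal.ofReal_ne_top

lemma height_eq_one {x : E} (hx : x ∈ crossSection C e) : height e x = 1 := by
  rw [height, hx.2, ENNReal.ofReal_one]

lemma IsConicFun.iInf {ι : Sort*} [Nonempty ι] {V : ι → E → ENNReal}
    (h : ∀ i, IsConicFun C (V i)) : IsConicFun C (fun x => ⨅ i, V i x) where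
  zero := by simp [(h _).zero]
  mono x hx y hxy := iInf_mono fun i => (h i).mono x hx y hxy
  smul x hx c hc := by
    rw [ENNReal.mul_iInf_of_ne (by simpa using hc) ENNReal.ofReal_ne_top]
    exact iInf_congr fun i => (h i).smul x hx c hc

lemma IsConicFun.iSup {ι : Sort*} {V : ι → E → ENNReal}
    (h : ∀ i, IsConicFun C (V i)) : IsConicFun C (fun x => ⨆ i, V i x) where
  zero := by simp [(h _).zero]
  mono x hx y hxy := iSup_mono fun i => (h i).mono x hx y hxy
  smul x hx c hc := by
    rw [ENNReal.mul_iSup]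
    exact iSup_congr fun i => (h i).smul x hx c hc

lemma IsConicFun.const_mul (h : IsConicFun C V) (c : ENNReal) :
    IsConicFun C (fun x => c * V x) where
  zero := by simp [h.zero]
  mono x hx y hxy := by gcongr; exact h.mono x hx y hxy
  smul x hx d hd := by rw [h.smul x hx d hd, mul_left_comm]

lemma IsConicFun.max (h : IsConicFun C V) (h' : IsConicFun C W) :
    IsConicFun C (fun x => max (V x) (W x)) where
  zero := by simp [h.zero, h'.zero]
  mono x hx y hxy := max_le_max (h.mono x hx y hxy) (h'.mono x hx y hxy)
  smul x hx d hd := by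
    rw [h.smul x hx d hd, h'.smul x hx d hd, mul_max]

lemma IsConicFun.comp (hT : IsConicFamily C T) (h : IsConicFun C V) (a : A) (b : B) :
    IsConicFun C (fun x => V (T a b x)) where
  zero := by rw [hT.map_zero, h.zero]
  mono x hx y hxy := h.mono _ (hT.mem a b x hx) _ (hT.mono a b x hx y hxy)
  smul x hx c hc := by rw [hT.smul a b x hx c hc, h.smul _ (hT.mem a b x hx) c hc]

lemma IsConicFun.conicShapley [Nonempty A] (hT : IsConicFamily C T) (h : IsConicFun C V) :
    IsConicFun C (conicShapley T V) :=
  IsConicFun.iInf fun a => IsConicFun.iSup fun b => h.comp hT a b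

lemma IsConicFun.conicShapley_iterate [Nonempty A] (hT : IsConicFamily C T)
    (h : IsConicFun C V) (k : ℕ) : IsConicFun C ((EscapeRate.conicShapley T)^[k] V) := by
  induction k with
  | zero => exact h
  | succ k ih => rw [Function.iterate_succ_apply']; exact ih.conicShapley hT

lemma conicShapley_mono (hT : IsConicFamily C T) (h : ∀ x ∈ C, V x ≤ W x) :
    ∀ x ∈ C, conicShapley T V x ≤ conicShapley T W x := fun x hx =>
  iInf_mono fun a => iSup_mono fun b => h _ (hT.mem a b x hx)

lemma conicShapley_iterate_mono (hT : IsConicFamily C T) (h : ∀ x ∈ C, V x ≤ W x) (k : ℕ) :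
    ∀ x ∈ C, (conicShapley T)^[k] V x ≤ (conicShapley T)^[k] W x := by
  induction k with
  | zero => exact h
  | succ k ih =>
    simp only [Function.iterate_succ_apply']
    exact conicShapley_mono hT ih

lemma conicShapley_iterate_le_pow_mul (hT : IsConicFamily C T) {c : ENNReal} (hc0 : c ≠ 0)
    (hc : c ≠ ⊤) (h : ∀ x ∈ C, conicShapley T V x ≤ c * V x) (k : ℕ) :
    ∀ x ∈ C, (conicShapley T)^[k] V x ≤ c ^ k * V x := by
  induction k with
  | zero => simp
  | succ k ih =>
    intro x hx
    rw [Function.iterate_succ_apply']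
    refine (conicShapley_mono hT ih x hx).trans ?_
    rw [conicShapley_const_mul (pow_ne_zero _ hc0) (ENNReal.pow_ne_top hc), pow_succ, mul_assoc]
    gcongr
    exact h x hx

lemma IsConicFun.le_iSup_mul_height [FiniteDimensional ℝ E]
    (he : e ∈ interior (ProperCone.innerDual (C : Set E) : Set E)) (hV : IsConicFun C V)
    {x : E} (hx : x ∈ C) : V x ≤ (⨆ y ∈ crossSection C e, V y) * height e x := by
  rcases eq_or_ne x 0 with rfl | hx0
  · simp [hV.zero]
  have hpos := inner_pos_of_mem he hx hx0
  have h := inv_inner_smul_mem_crossSection hx hpos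
  have h2 := hV.smul _ h.1 _ hpos
  rw [smul_smul, mul_inv_cancel₀ hpos.ne', one_smul] at h2
  rw [h2, mul_comm, height]
  gcongr
  exact le_iSup₂ (f := fun y (_ : y ∈ crossSection C e) => V y) _ h

/-- Harnack inequality: the value at an interior point controls a conic function. -/
lemma exists_le_mul_height_mul [FiniteDimensional ℝ E]
    (he : e ∈ interior (ProperCone.innerDual (C : Set E) : Set E))
    {u : E} (hu : u ∈ interior (C : Set E)) :
    ∃ K : ℝ, 0 < K ∧ ∀ V, IsConicFun C V →
      ∀ x ∈ C, V x ≤ ENNReal.ofReal K * height e x * V u := by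
  obtain ⟨K, hK, hdom⟩ := exists_dominates he hu
  refine ⟨K, hK, fun V hV x hx => ?_⟩
  rcases eq_or_ne x 0 with rfl | hx0
  · simp [hV.zero]
  have hpos := inner_pos_of_mem he hx hx0
  refine (hV.mono x hx _ (hdom x hx)).trans ?_
  rw [hV.smul _ (interior_subset hu) _ (mul_pos hK hpos), ENNReal.ofReal_mul hK.le, height]

/-- Whatever the actions, one turn leaves u above μ u, so monotonicity and homogeneity suffice. Used
for lower bounds on growth and for positivity. -/
lemma le_conicShapley [Nonempty B] {u : E} (hu : u ∈ C) {μ : ℝ} (hμ : 0 < μ)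
    (h : ∀ a b, T a b u - μ • u ∈ C) (hV : IsConicFun C V) :
    ENNReal.ofReal μ * V u ≤ conicShapley T V u := by
  rw [← hV.smul u hu μ hμ]
  exact le_iInf fun a => (hV.mono _ (cone_smul_mem hu hμ.le) _
    (h a (Classical.arbitrary B))).trans (le_iSup (fun b => V (T a b u)) _)

end ConicFunctions

/-! ### Consequences of compactness of the action spaces -/

section Continuity

variable {E : Type*} [NormedAddCommGroup E] [InnerProductSpace ℝ E]
  {A B : Type*} [TopologicalSpace A] [TopologicalSpace B]
  {C : ProperCone ℝ E} {e : E} {T : A → B → E → E} {V : E → ENNReal}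

/-- A supremum of a jointly continuous function over the compact B is continuous in (x, a); the
infimum over the compact A then preserves continuity in x. -/
lemma continuousOn_conicShapley [CompactSpace A] [CompactSpace B] (hT : IsConicFamily C T)
    (hcont : ContinuousOn (fun p : A × B × E => T p.1 p.2.1 p.2.2)
      (univ ×ˢ (univ ×ˢ (C : Set E)))) (hV : ContinuousOn V (C : Set E)) :
    ContinuousOn (conicShapley T V) (C : Set E) := by
  rw [continuousOn_iff_continuous_domRestrict]
  have hT' : Continuous fun p : (↥(C : Set E) × A) × B => T p.1.2 p.2 (p.1.1 : E) :=
    hcont.comp_continuous (f := fun p : (↥(C : Set E) × A) × B => (p.1.2, p.2, (p.1.1 : E)))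
      (by fun_prop) fun p => ⟨mem_univ _, mem_univ _, p.1.1.2⟩
  have h1 : Continuous fun p : (↥(C : Set E) × A) × B => V (T p.1.2 p.2 (p.1.1 : E)) :=
    hV.comp_continuous hT' fun p => hT.mem _ _ _ p.1.1.2
  have h2 := isCompact_univ.continuous_sSup
    (f := fun (p : ↥(C : Set E) × A) (b : B) => V (T p.2 b (p.1 : E))) h1
  have h3 := isCompact_univ.continuous_sInf
    (f := fun (x : ↥(C : Set E)) (a : A) =>
      sSup ((fun b : B => V (T a b (x : E))) '' univ)) h2
  simp only [image_univ, sSup_range, sInf_range] at h3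
  exact h3

lemma continuous_apply_of_mem
    (hcont : ContinuousOn (fun p : A × B × E => T p.1 p.2.1 p.2.2)
      (univ ×ˢ (univ ×ˢ (C : Set E)))) {x : E} (hx : x ∈ C) :
    Continuous fun p : A × B => T p.1 p.2 x :=
  hcont.comp_continuous (f := fun p : A × B => (p.1, p.2, x))
    (by fun_prop) fun _ => ⟨mem_univ _, mem_univ _, hx⟩

/-- The Harnack inequality applies to each conic function x ↦ ⟨T_ab x, e⟩, whose value at a fixed
interior point is bounded over A × B. -/
lemma exists_height_le [FiniteDimensional ℝ E] [CompactSpace A] [CompactSpace B]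
    (he : e ∈ interior (ProperCone.innerDual (C : Set E) : Set E))
    (hint : (interior (C : Set E)).Nonempty) (hT : IsConicFamily C T)
    (hcont : ContinuousOn (fun p : A × B × E => T p.1 p.2.1 p.2.2)
      (univ ×ˢ (univ ×ˢ (C : Set E)))) :
    ∃ M : ENNReal, M ≠ 0 ∧ M ≠ ⊤ ∧
      ∀ a b, ∀ x ∈ C, height e (T a b x) ≤ M * height e x := by
  obtain ⟨u, hu⟩ := hint
  obtain ⟨K, hK, h⟩ := exists_le_mul_height_mul he hu
  have hc := (continuous_apply_of_mem hcont (interior_subset hu)).inner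
    (continuous_const (y := e)) (𝕜 := ℝ)
  obtain ⟨R, hR⟩ := isCompact_univ.exists_bound_of_continuousOn hc.continuousOn
  -- The maximum with 1 keeps the constant nonzero.
  refine ⟨ENNReal.ofReal (K * max R 1), ?_, ENNReal.ofReal_ne_top, fun a b x hx => ?_⟩
  · simp [hK]
  · refine (h _ ((isConicFun_height he).comp hT a b) x hx).trans ?_
    rw [ENNReal.ofReal_mul hK.le, mul_right_comm]
    gcongr
    exact ENNReal.ofReal_le_ofReal
      ((le_abs_self _).trans ((hR (a, b) (mem_univ _)).trans (le_max_left _ _)))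

lemma exists_smul_le_apply [CompactSpace A] [CompactSpace B] (hT : IsConicFamily C T)
    (hcont : ContinuousOn (fun p : A × B × E => T p.1 p.2.1 p.2.2)
      (univ ×ˢ (univ ×ˢ (C : Set E)))) {u : E} (hu : u ∈ interior (C : Set E)) :
    ∃ μ : ℝ, 0 < μ ∧ ∀ a b, T a b u - μ • u ∈ C := by
  have hc := continuous_apply_of_mem hcont (interior_subset hu)
  have h : ∀ᶠ μ in 𝓝 (0 : ℝ), ∀ p ∈ (univ : Set (A × B)),
      T p.1 p.2 u - μ • u ∈ interior (C : Set E) := by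
    refine isCompact_univ.eventually_forall_of_forall_eventually fun p _ => ?_
    have hcont' : Continuous fun z : ℝ × A × B => T z.2.1 z.2.2 u - z.1 • u := by fun_prop
    refine hcont'.continuousAt.eventually_mem (isOpen_interior.mem_nhds ?_)
    simpa using hT.mem_interior _ _ u hu
  obtain ⟨μ, hμ, hpos⟩ :=
    ((h.filter_mono (nhdsWithin_le_nhds (s := Ioi 0))).and self_mem_nhdsWithin).exists
  exact ⟨μ, hpos, fun a b => interior_subset (hμ (a, b) (mem_univ _))⟩

/-- Up to a factor close to one, finitely many actions of the second player dominate
all the others. -/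
lemma exists_finset_dominates [CompactSpace B] (hT : IsConicFamily C T)
    (hcont : ContinuousOn (fun p : A × B × E => T p.1 p.2.1 p.2.2)
      (univ ×ˢ (univ ×ˢ (C : Set E)))) {x : E} (hx : x ∈ interior (C : Set E)) (a : A)
    {r : ℝ} (hr : 1 < r) :
    ∃ t : Finset B, ∀ b', ∃ b ∈ t, r • T a b x - T a b' x ∈ C := by
  have hc := continuous_apply_of_mem hcont (interior_subset hx)
  -- At b' = b the difference is (r - 1) T_ab x, an interior point, so it stays interior for b' near
  -- b.
  obtain ⟨t, -, ht⟩ := isCompact_univ.elim_nhds_subcover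
    (fun b => {b' : B | r • T a b x - T a b' x ∈ interior (C : Set E)}) fun b _ => by
      have hcont' : Continuous fun b' : B => r • T a b x - T a b' x := by fun_prop
      refine hcont'.continuousAt.eventually_mem (isOpen_interior.mem_nhds ?_)
      have := smul_mem_interior (hT.mem_interior a b x hx) (sub_pos.2 hr)
      rwa [sub_smul, one_smul] at this
  refine ⟨t, fun b' => ?_⟩
  obtain ⟨b, hb, hb'⟩ := mem_iUnion₂.1 (ht (mem_univ b'))
  exact ⟨b, hb, interior_subset hb'⟩

end Continuity

/-! ### The escape rate by subadditivity -/

section Growth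

variable {E : Type*} [NormedAddCommGroup E] [InnerProductSpace ℝ E]
  {A B : Type*} {C : ProperCone ℝ E} {e : E} {T : A → B → E → E}

/-- The maximum on the cross section of the `k`-th iterate of the Shapley operator at `⟨·, e⟩`. -/
def growth (C : ProperCone ℝ E) (e : E) (T : A → B → E → E) (k : ℕ) : ENNReal :=
  ⨆ x ∈ crossSection C e, (conicShapley T)^[k] (height e) x

/-- The logarithm of `growth`. -/
def logGrowth (C : ProperCone ℝ E) (e : E) (T : A → B → E → E) (k : ℕ) : ℝ :=
  Real.log (growth C e T k).toReal

lemma growth_le_of_le {c : ENNReal} {k : ℕ}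
    (h : ∀ x ∈ C, (conicShapley T)^[k] (height e) x ≤ c * height e x) :
    growth C e T k ≤ c :=
  iSup₂_le fun x hx => by simpa [height_eq_one hx] using h x hx.1

variable [FiniteDimensional ℝ E] [Nonempty A]
  (he : e ∈ interior (ProperCone.innerDual (C : Set E) : Set E))
  (hT : IsConicFamily C T)

include he hT

lemma iterate_height_le_growth_mul (k : ℕ) {x : E} (hx : x ∈ C) :
    (conicShapley T)^[k] (height e) x ≤ growth C e T k * height e x :=
  ((isConicFun_height he).conicShapley_iterate hT k).le_iSup_mul_height he hx

/-- Φ^l h ≤ g_l h, and Φ^k is monotone and commutes with the finite nonzero scalar g_l. -/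
lemma growth_add_le {k l : ℕ} (h0 : growth C e T l ≠ 0) (htop : growth C e T l ≠ ⊤) :
    growth C e T (k + l) ≤ growth C e T k * growth C e T l := by
  refine growth_le_of_le fun x hx => ?_
  rw [Function.iterate_add_apply]
  refine (conicShapley_iterate_mono hT
    (fun y hy => iterate_height_le_growth_mul he hT l hy) k x hx).trans ?_
  rw [conicShapley_iterate_const_mul h0 htop, mul_comm (growth C e T k), mul_assoc]
  exact mul_le_mul_right (iterate_height_le_growth_mul he hT k hx) _

variable [TopologicalSpace A] [TopologicalSpace B] [CompactSpace A] [CompactSpace B]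
  (hint : (interior (C : Set E)).Nonempty)
  (hcont : ContinuousOn (fun p : A × B × E => T p.1 p.2.1 p.2.2)
      (univ ×ˢ (univ ×ˢ (C : Set E))))

include hint hcont

lemma growth_ne_top (k : ℕ) : growth C e T k ≠ ⊤ := by
  obtain ⟨M, hM0, hM, h⟩ := exists_height_le he hint hT hcont
  exact ne_top_of_le_ne_top (ENNReal.pow_ne_top hM (n := k))
    (growth_le_of_le (conicShapley_iterate_le_pow_mul hT hM0 hM
      (fun x hx => iInf_le_of_le (Classical.arbitrary A) (iSup_le fun b => h _ b x hx)) k))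

variable [Nonempty B] [Nontrivial E]

/-- At an interior point u every turn retains at least a factor μ, so Φ^k h(u) ≥ μ^k h(u). -/
lemma exists_pow_le_growth :
    ∃ μ : ℝ, 0 < μ ∧ ∀ k, ENNReal.ofReal μ ^ k ≤ growth C e T k := by
  obtain ⟨u, hu⟩ := hint
  obtain ⟨μ, hμ, h⟩ := exists_smul_le_apply hT hcont hu
  have hpos := inner_pos_of_mem_interior he hu
  have hle : ∀ k, ENNReal.ofReal μ ^ k * height e u ≤ (conicShapley T)^[k] (height e) u := by
    intro k
    induction k with
    | zero => simp
    | succ k ih =>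
      rw [Function.iterate_succ_apply', pow_succ', mul_assoc]
      exact (mul_le_mul_right ih _).trans (le_conicShapley (interior_subset hu) hμ h
        ((isConicFun_height he).conicShapley_iterate hT k))
  refine ⟨μ, hμ, fun k => ?_⟩
  have h1 := (hle k).trans (iterate_height_le_growth_mul he hT k (interior_subset hu))
  exact (ENNReal.mul_le_mul_iff_left (by simpa [height] using hpos) (height_ne_top u)).1 h1

lemma growth_ne_zero (k : ℕ) : growth C e T k ≠ 0 := by
  obtain ⟨μ, hμ, h⟩ := exists_pow_le_growth he hT hint hcont
  exact ((ENNReal.pow_pos (by simpa using hμ) k).trans_le (h k)).ne'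

lemma growth_eq (k : ℕ) : growth C e T k = ENNReal.ofReal (Real.exp (logGrowth C e T k)) := by
  have h0 := growth_ne_zero he hT hint hcont k
  have h1 := growth_ne_top he hT hint hcont k
  rw [logGrowth, Real.exp_log (ENNReal.toReal_pos h0 h1), ENNReal.ofReal_toReal h1]

/-- The escape rate, as a limit and as an infimum. -/
lemma exists_growthRate :
    ∃ ρ : ℝ, Tendsto (fun k : ℕ => logGrowth C e T k / k) atTop (𝓝 ρ) ∧
      ∀ k : ℕ, k * ρ ≤ logGrowth C e T k := by
  have h0 := growth_ne_zero he hT hint hcont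
  have h1 := growth_ne_top he hT hint hcont
  have hpos : ∀ k, 0 < (growth C e T k).toReal := fun k => ENNReal.toReal_pos (h0 k) (h1 k)
  have hsub : Subadditive (logGrowth C e T) := by
    intro m n
    rw [logGrowth, logGrowth, logGrowth, ← Real.log_mul (hpos m).ne' (hpos n).ne',
      ← ENNReal.toReal_mul]
    exact Real.log_le_log (hpos _) (ENNReal.toReal_mono (ENNReal.mul_ne_top (h1 m) (h1 n))
      (growth_add_le he hT (h0 n) (h1 n)))
  obtain ⟨μ, hμ, h⟩ := exists_pow_le_growth he hT hint hcont
  have hlow : ∀ k : ℕ, k * Real.log μ ≤ logGrowth C e T k := by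
    intro k
    rw [← Real.log_pow]
    refine Real.log_le_log (pow_pos hμ k) ?_
    have := ENNReal.toReal_mono (h1 k) (h k)
    rwa [ENNReal.toReal_pow, ENNReal.toReal_ofReal hμ.le] at this
  have hbdd : BddBelow (range fun n : ℕ => logGrowth C e T n / n) := by
    -- The minimum with 0 covers n = 0, where the quotient is 0/0 = 0.
    refine ⟨min (Real.log μ) 0, ?_⟩
    rintro _ ⟨n, rfl⟩
    rcases n.eq_zero_or_pos with rfl | hn
    · simp
    · have hn' : (0 : ℝ) < n := Nat.cast_pos.2 hn
      refine (min_le_left _ _).trans ((le_div_iff₀ hn').2 ?_)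
      rw [mul_comm]
      exact hlow n
  refine ⟨hsub.lim, hsub.tendsto_lim hbdd, fun k => ?_⟩
  rcases k.eq_zero_or_pos with rfl | hk
  · simpa using hlow 0
  · have hk' : (0 : ℝ) < k := Nat.cast_pos.2 hk
    rw [mul_comm]
    exact (le_div_iff₀ hk').1 (hsub.lim_le_div hbdd hk.ne')

end Growth

/-! ### The exponential with values in [0, ∞] -/

section Exponential

/-- The real exponential, with values in `[0, ∞]`. -/
def expE (t : ℝ) : ENNReal := ENNReal.ofReal (Real.exp t)

lemma expE_ne_zero (t : ℝ) : expE t ≠ 0 := by simpa [expE] using Real.exp_pos t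

lemma expE_ne_top (t : ℝ) : expE t ≠ ⊤ := ENNReal.ofReal_ne_top

lemma expE_add (s t : ℝ) : expE (s + t) = expE s * expE t := by
  rw [expE, Real.exp_add, ENNReal.ofReal_mul (Real.exp_pos s).le, expE, expE]

lemma expE_zero : expE 0 = 1 := by simp [expE]

lemma expE_pow (t : ℝ) (k : ℕ) : expE t ^ k = expE (k * t) := by
  rw [expE, expE, ← ENNReal.ofReal_pow (Real.exp_pos t).le, Real.exp_nat_mul]

lemma expE_le {s t : ℝ} : expE s ≤ expE t ↔ s ≤ t := by
  rw [expE, expE, ENNReal.ofReal_le_ofReal_iff (Real.exp_pos t).le, Real.exp_le_exp]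

lemma expE_lt {s t : ℝ} : expE s < expE t ↔ s < t := by
  rw [← not_le, expE_le, not_le]

end Exponential

/-! ### Subsolutions above the escape rate -/

section PerturbedShapley

variable {E A B : Type*} {T : A → B → E → E}

/-- The perturbed Shapley operator `V ↦ max (F V) (η V)`, whose iterates are positive. -/
def perturbedShapley (T : A → B → E → E) (η : ENNReal) (V : E → ENNReal) (x : E) : ENNReal :=
  max (conicShapley T V x) (η * V x)

lemma pow_mul_le_perturbedShapley_iterate (η : ENNReal) (V : E → ENNReal) (k : ℕ) (x : E) :
    η ^ k * V x ≤ (perturbedShapley T η)^[k] V x := by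
  induction k with
  | zero => simp
  | succ k ih =>
    rw [Function.iterate_succ_apply', pow_succ', mul_assoc]
    exact (mul_le_mul_right ih _).trans (le_max_right _ _)

end PerturbedShapley

section Subsolution

variable {E : Type*} [NormedAddCommGroup E] [InnerProductSpace ℝ E]
  {A B : Type*} {C : ProperCone ℝ E} {e : E} {T : A → B → E → E} {V W : E → ENNReal}

lemma IsConicFun.perturbedShapley_iterate [Nonempty A] (hT : IsConicFamily C T)
    (h : IsConicFun C V) (η : ENNReal) (k : ℕ) :
    IsConicFun C ((perturbedShapley T η)^[k] V) := by
  induction k with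
  | zero => exact h
  | succ k ih =>
    rw [Function.iterate_succ_apply']
    exact (ih.conicShapley hT).max (ih.const_mul η)

lemma continuousOn_perturbedShapley_iterate [TopologicalSpace A] [TopologicalSpace B]
    [CompactSpace A] [CompactSpace B] (hT : IsConicFamily C T)
    (hcont : ContinuousOn (fun p : A × B × E => T p.1 p.2.1 p.2.2)
      (univ ×ˢ (univ ×ˢ (C : Set E)))) (hV : ContinuousOn V (C : Set E))
    {η : ENNReal} (hη : η ≠ ⊤) (k : ℕ) :
    ContinuousOn ((perturbedShapley T η)^[k] V) (C : Set E) := by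
  induction k with
  | zero => exact hV
  | succ k ih =>
    rw [Function.iterate_succ_apply']
    exact (continuousOn_conicShapley hT hcont ih).sup
      ((ENNReal.continuous_const_mul hη).comp_continuousOn ih)

/-- An error proportional to `height` is amplified at most by M, since `height` grows at most by M
per turn. -/
lemma conicShapley_add_mul_height_le [Nonempty A] [Nonempty B] {M : ENNReal}
    (hM : ∀ a b, ∀ x ∈ C, height e (T a b x) ≤ M * height e x) (V : E → ENNReal) (d : ENNReal)
    {x : E} (hx : x ∈ C) :
    conicShapley T (fun y => V y + d * height e y) x ≤
      conicShapley T V x + d * M * height e x := by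
  rw [conicShapley, conicShapley, ENNReal.iInf_add]
  refine iInf_mono fun a => ?_
  rw [ENNReal.iSup_add]
  refine iSup_mono fun b => ?_
  rw [mul_assoc]
  gcongr
  exact hM a b x hx

variable [FiniteDimensional ℝ E] [Nonempty A] [Nonempty B]
  (he : e ∈ interior (ProperCone.innerDual (C : Set E) : Set E))
  (hT : IsConicFamily C T)
  [TopologicalSpace A] [TopologicalSpace B] [CompactSpace A] [CompactSpace B]
  (hint : (interior (C : Set E)).Nonempty)
  (hcont : ContinuousOn (fun p : A × B × E => T p.1 p.2.1 p.2.2)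
      (univ ×ˢ (univ ×ˢ (C : Set E))))

include he hT hint hcont

/-- For fixed k the perturbation costs O(η), so a strict bound on `growth` at k survives for small
η. -/
lemma exists_perturbedShapley_iterate_le (k : ℕ) :
    ∃ c : ENNReal, c ≠ ⊤ ∧ ∀ η ≤ 1, ∀ x ∈ C, (perturbedShapley T η)^[k] (height e) x ≤
      (conicShapley T)^[k] (height e) x + η * c * height e x := by
  obtain ⟨M, -, hM, hM'⟩ := exists_height_le he hint hT hcont
  induction k with
  | zero => exact ⟨0, by simp, by simp⟩
  | succ k ih =>
    obtain ⟨c, hc, h⟩ := ih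
    have hg := growth_ne_top he hT hint hcont k
    -- The term c M is the earlier error carried through Φ; the rest bounds the new branch η W_k,
    -- using η ≤ 1.
    refine ⟨c * M + (growth C e T k + c), by finiteness, fun η hη x hx => ?_⟩
    rw [Function.iterate_succ_apply', Function.iterate_succ_apply']
    refine max_le ?_ ?_
    · refine (conicShapley_mono hT (h η hη) x hx).trans
        ((conicShapley_add_mul_height_le hM' _ _ hx).trans ?_)
      refine add_le_add le_rfl (mul_le_mul_left ?_ _)
      rw [mul_assoc]
      exact mul_le_mul_right le_self_add _
    · refine le_trans ?_ le_add_self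
      rw [mul_assoc]
      gcongr
      refine (h η hη x hx).trans ?_
      refine le_trans ?_ (mul_le_mul_left le_add_self _)
      rw [add_mul]
      refine add_le_add (iterate_height_le_growth_mul he hT k hx) ?_
      gcongr
      exact mul_le_of_le_one_left' hη

/-- Positive continuous subsolutions exist above the escape rate. -/
theorem exists_subsolution {l : ℝ} {k : ℕ} (hk : 0 < k) (h : growth C e T k < expE (k * l)) :
    ∃ V : E → ENNReal, IsConicFun C V ∧ ContinuousOn V (C : Set E) ∧
      (∀ x ∈ C, V x ≤ height e x) ∧
      (∃ c : ENNReal, c ≠ 0 ∧ ∀ x ∈ C, c * height e x ≤ V x) ∧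
      ∀ x ∈ C, conicShapley T V x ≤ expE l * V x := by
  obtain ⟨c, hc, hle⟩ := exists_perturbedShapley_iterate_le he hT hint hcont k
  -- η is chosen so that g_k + η c still lies below e^{kl}.
  obtain ⟨n, hn, hnlt⟩ := ENNReal.exists_nnreal_pos_mul_lt hc (tsub_pos_of_lt h).ne'
  set η : ENNReal := min 1 n with hη
  have hη0 : η ≠ 0 := by simp [hη, hn.ne']
  have hη1 : η ≤ 1 := min_le_left _ _
  have hηtop : η ≠ ⊤ := ne_top_of_le_ne_top ENNReal.one_ne_top hη1
  set W : ℕ → E → ENNReal := fun j => (perturbedShapley T η)^[j] (height e) with hW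
  have hWcon : ∀ j, IsConicFun C (W j) := (isConicFun_height he).perturbedShapley_iterate hT η
  have hWcont : ∀ j, ContinuousOn (W j) (C : Set E) :=
    continuousOn_perturbedShapley_iterate hT hcont continuous_height.continuousOn hηtop
  have hWstep : ∀ j x, conicShapley T (W j) x ≤ W (j + 1) x := fun j x => by
    simp only [hW, Function.iterate_succ_apply']
    exact le_max_left _ _
  have hWk : ∀ x ∈ C, W k x ≤ expE (k * l) * height e x := by
    intro x hx
    refine (hle η hη1 x hx).trans ((add_le_add
      (iterate_height_le_growth_mul he hT k hx) le_rfl).trans ?_)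
    rw [← add_mul]
    gcongr
    calc growth C e T k + η * c ≤ growth C e T k + (expE (k * l) - growth C e T k) := by
          gcongr
          exact (mul_le_mul_left (min_le_right _ _) _).trans hnlt.le
      _ = expE (k * l) := add_tsub_cancel_of_le h.le
  have : Nonempty (Fin k) := ⟨⟨0, hk⟩⟩
  set V : E → ENNReal := fun x => ⨅ j : Fin k, expE (-(j * l)) * W j x with hV
  have hVle : ∀ (j : Fin k) x, V x ≤ expE (-(j * l)) * W j x := fun j x => iInf_le _ j
  have hΦ : ∀ j, j < k → ∀ x ∈ C, conicShapley T V x ≤ expE (-(j * l)) * W (j + 1) x := by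
    intro j hj x hx
    refine (conicShapley_mono hT (fun y _ => hVle ⟨j, hj⟩ y) x hx).trans ?_
    rw [conicShapley_const_mul (expE_ne_zero _) (expE_ne_top _)]
    exact mul_le_mul_right (hWstep j x) _
  refine ⟨V, IsConicFun.iInf fun j => (hWcon j).const_mul _, ?_, fun x _ => ?_, ?_,
    fun x hx => ?_⟩
  · simp only [hV, ← Finset.inf_univ_eq_iInf]
    exact ContinuousOn.finset_inf_apply fun j _ =>
      (ENNReal.continuous_const_mul (expE_ne_top _)).comp_continuousOn (hWcont j)
  · simpa [hW, expE_zero] using hVle ⟨0, hk⟩ x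
  · refine ⟨⨅ j : Fin k, expE (-(j * l)) * η ^ (j : ℕ), ?_, fun x _ => le_iInf fun j => ?_⟩
    · obtain ⟨j, hj⟩ := exists_eq_ciInf_of_finite
        (f := fun j : Fin k => expE (-(j * l)) * η ^ (j : ℕ))
      rw [← hj]
      exact mul_ne_zero (expE_ne_zero _) (pow_ne_zero _ hη0)
    · refine (mul_le_mul_left (iInf_le _ j) _).trans ?_
      rw [mul_assoc]
      exact mul_le_mul_right (pow_mul_le_perturbedShapley_iterate η _ _ x) _
  · rw [hV, ENNReal.mul_iInf_of_ne (expE_ne_zero _) (expE_ne_top _)]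
    refine le_iInf fun ⟨j, hj⟩ => ?_
    rw [← mul_assoc, ← expE_add]
    -- The term j + 1 is reached by applying Φ to the term j; the term 0 is reached from the last
    -- index k - 1, through W_k ≤ e^{kl} h.
    rcases j with _ | j
    · obtain ⟨m, rfl⟩ := Nat.exists_eq_succ_of_ne_zero hk.ne'
      refine (hΦ m m.lt_succ_self x hx).trans ((mul_le_mul_right (hWk x hx) _).trans ?_)
      rw [← mul_assoc, ← expE_add]
      refine le_of_eq ?_
      congr 2
      push_cast
      ring
    · refine (hΦ j (by omega) x hx).trans (le_of_eq ?_)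
      congr 2
      push_cast
      ring

end Subsolution

/-! ### A potential for Max below the escape rate -/

section Superharmonic

variable {E : Type*} [NormedAddCommGroup E] [InnerProductSpace ℝ E]
  {A B : Type*}
  {C : ProperCone ℝ E} {e : E} {T : A → B → E → E}

/-- The maximum of the first `n + 1` discounted iterates of the Shapley operator
at `⟨·, e⟩`. -/
def discountedMax (e : E) (T : A → B → E → E) (l : ℝ) (n : ℕ) (x : E) : ENNReal :=
  ⨆ j : Fin (n + 1), expE (-(j * l)) * (conicShapley T)^[j] (height e) x

/-- The term j = 0 is `height`, and each later term is e^{-l} Φ of the preceding one. -/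
lemma discountedMax_le (hT : IsConicFamily C T) (l : ℝ) (n : ℕ) {x : E} (hx : x ∈ C) :
    discountedMax e T l n x ≤
      max (height e x) (expE (-l) * conicShapley T (discountedMax e T l n) x) := by
  refine iSup_le fun ⟨j, hj⟩ => ?_
  rcases j with _ | j
  · simp [expE_zero]
  · refine le_trans ?_ (le_max_right _ _)
    rw [show -(((j + 1 : ℕ) : ℝ) * l) = -l + -(j * l) by push_cast; ring, expE_add, mul_assoc,
      Function.iterate_succ_apply', ← conicShapley_const_mul (expE_ne_zero _) (expE_ne_top _)]
    refine mul_le_mul_right (conicShapley_mono hT (fun y _ => ?_) x hx) _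
    exact le_iSup (fun i : Fin (n + 1) => expE (-(i * l)) * (conicShapley T)^[i] (height e) y)
      ⟨j, by omega⟩

variable [FiniteDimensional ℝ E] [Nonempty A] [TopologicalSpace A] [TopologicalSpace B]
  [CompactSpace A] [CompactSpace B]
  (he : e ∈ interior (ProperCone.innerDual (C : Set E) : Set E))
  (hT : IsConicFamily C T)
  (hint : (interior (C : Set E)).Nonempty)
  (hcont : ContinuousOn (fun p : A × B × E => T p.1 p.2.1 p.2.2)
      (univ ×ˢ (univ ×ˢ (C : Set E))))

include he hT hint hcont

lemma iSup_discountedMax_ne_top (l : ℝ) (n : ℕ) :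
    ⨆ x ∈ crossSection C e, discountedMax e T l n x ≠ ⊤ := by
  have hle : ⨆ x ∈ crossSection C e, discountedMax e T l n x ≤
      ⨆ j : Fin (n + 1), expE (-(j * l)) * growth C e T j :=
    iSup₂_le fun x hx => iSup_mono fun j => mul_le_mul_right
      (le_iSup₂ (f := fun x (_ : x ∈ crossSection C e) => (conicShapley T)^[j] (height e) x) x hx) _
  obtain ⟨j, hj⟩ := exists_eq_ciSup_of_finite
    (f := fun j : Fin (n + 1) => expE (-(j * l)) * growth C e T j)
  rw [← hj] at hle
  exact ne_top_of_le_ne_top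
    (ENNReal.mul_ne_top (expE_ne_top _) (growth_ne_top he hT hint hcont j)) hle

variable [Nonempty B] [Nontrivial E]

/-- The last term j = n alone gives the bound, which diverges with n when l < ρ. -/
lemma expE_le_iSup_discountedMax {ρ : ℝ} (hρ : ∀ k : ℕ, k * ρ ≤ logGrowth C e T k)
    (l : ℝ) (n : ℕ) :
    expE (n * (ρ - l)) ≤ ⨆ x ∈ crossSection C e, discountedMax e T l n x := by
  rw [show n * (ρ - l) = -(n * l) + n * ρ by ring, expE_add]
  refine (mul_le_mul_right ((expE_le.2 (hρ n)).trans_eq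
    (growth_eq he hT hint hcont n).symm) _).trans ?_
  rw [growth, ENNReal.mul_iSup]
  refine iSup_mono fun x => ?_
  rw [ENNReal.mul_iSup]
  refine iSup_mono fun hx => ?_
  exact le_iSup (fun i : Fin (n + 1) => expE (-(i * l)) * (conicShapley T)^[i] (height e) x)
    ⟨n, by omega⟩

/-- Below the escape rate, there is a positive function on the interior of the cone whose growth
at a given rate can be ensured by the second player. -/
theorem exists_superharmonic {ρ l : ℝ} (hρ : ∀ k : ℕ, k * ρ ≤ logGrowth C e T k) (hl : l < ρ) :
    ∃ H : E → ENNReal, (∀ x ∈ interior (C : Set E), H x ≠ 0 ∧ H x ≤ height e x) ∧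
      ∀ x ∈ interior (C : Set E), ∀ a, ∃ b, expE l * H x ≤ H (T a b x) := by
  -- The gap ρ - l' makes the normalizing constants diverge; the gap l' - l pays for the reduction
  -- to finitely many actions.
  obtain ⟨l', hl', hl'ρ⟩ := exists_between hl
  set U := discountedMax e T l' with hU
  set m : ℕ → ENNReal := fun n => ⨆ x ∈ crossSection C e, U n x with hm
  have hUcon : ∀ n, IsConicFun C (U n) := fun n => IsConicFun.iSup fun j =>
    ((isConicFun_height he).conicShapley_iterate hT j).const_mul _
  have hmtop : ∀ n, m n ≠ ⊤ := iSup_discountedMax_ne_top he hT hint hcont l'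
  have hmlow : ∀ n : ℕ, expE (n * (ρ - l')) ≤ m n :=
    expE_le_iSup_discountedMax he hT hint hcont hρ l'
  have hm0 : ∀ n, m n ≠ 0 := fun n =>
    ((pos_iff_ne_zero.2 (expE_ne_zero _)).trans_le (hmlow n)).ne'
  have hinv : Tendsto (fun n => (m n)⁻¹) atTop (𝓝 0) := by
    rw [← ENNReal.inv_top, tendsto_inv_iff]
    refine tendsto_nhds_top_mono ?_ (Eventually.of_forall hmlow)
    exact ENNReal.tendsto_ofReal_atTop.comp (Real.tendsto_exp_atTop.comp
      (tendsto_natCast_atTop_atTop.atTop_mul_const (sub_pos.2 hl'ρ)))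
  set W : ℕ → E → ENNReal := fun n x => (m n)⁻¹ * U n x with hW
  have hWcon : ∀ n, IsConicFun C (W n) := fun n => (hUcon n).const_mul _
  have hWle : ∀ n, ∀ x ∈ C, W n x ≤ height e x := by
    intro n x hx
    refine (mul_le_mul_right ((hUcon n).le_iSup_mul_height he hx) _).trans_eq ?_
    rw [← mul_assoc, ENNReal.inv_mul_cancel (hm0 n) (hmtop n), one_mul]
  have hWstep : ∀ n, ∀ x ∈ C, W n x ≤
      max ((m n)⁻¹ * height e x) (expE (-l') * conicShapley T (W n) x) := by
    intro n x hx
    rw [hW, conicShapley_const_mul (ENNReal.inv_ne_zero.2 (hmtop n))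
      (ENNReal.inv_ne_top.2 (hm0 n)), mul_left_comm, ← mul_max]
    exact mul_le_mul_right (discountedMax_le hT l' n hx) _
  -- By compactness of [0, ∞] a single ultrafilter gives a limit at every point simultaneously.
  have hlim : ∀ x, ∃ y, Tendsto (fun n => W n x) (hyperfilter ℕ : Filter ℕ) (𝓝 y) := fun x => by
    obtain ⟨y, -, hy⟩ := isCompact_univ.ultrafilter_le_nhds
      ((hyperfilter ℕ).map fun n => W n x) (by simp)
    exact ⟨y, hy⟩
  choose H hH using hlim
  refine ⟨H, fun x hx => ⟨?_, ?_⟩, fun x hx a => ?_⟩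
  -- Harnack based at x gives m_n ≤ K U_n(x), a bound on W_n(x) from below that is independent of n.
  · obtain ⟨K, hK, hKle⟩ := exists_le_mul_height_mul he hx
    have h1 : ∀ n, 1 ≤ ENNReal.ofReal K * W n x := by
      intro n
      have h2 : m n ≤ ENNReal.ofReal K * U n x := iSup₂_le fun y hy => by
        simpa [height_eq_one hy] using hKle (U n) (hUcon n) y hy.1
      rw [hW, mul_left_comm, ← ENNReal.inv_mul_cancel (hm0 n) (hmtop n)]
      exact mul_le_mul_right h2 _
    have h3 : 1 ≤ ENNReal.ofReal K * H x :=
      ge_of_tendsto' (ENNReal.Tendsto.const_mul (hH x) (Or.inr ENNReal.ofReal_ne_top)) h1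
    rintro h0
    simp [h0] at h3
  · exact le_of_tendsto' (hH x) fun n => hWle n x (interior_subset hx)
  · have hr : 1 < Real.exp (l' - l) := Real.one_lt_exp_iff.2 (sub_pos.2 hl')
    obtain ⟨t, ht⟩ := exists_finset_dominates hT hcont hx a hr
    have ht0 : t.Nonempty := by
      obtain ⟨b, hb, -⟩ := ht (Classical.arbitrary B)
      exact ⟨b, hb⟩
    have hxC : x ∈ C := interior_subset hx
    have h1 : ∀ n, W n x ≤ max ((m n)⁻¹ * height e x)
        (expE (-l') * (expE (l' - l) * t.sup fun b => W n (T a b x))) := by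
      intro n
      refine (hWstep n x hxC).trans (max_le_max le_rfl (mul_le_mul_right ?_ _))
      refine (iInf_le _ a).trans (iSup_le fun b' => ?_)
      obtain ⟨b, hb, hbb'⟩ := ht b'
      refine ((hWcon n).mono _ (hT.mem a b' x hxC) _ hbb').trans ?_
      rw [(hWcon n).smul _ (hT.mem a b x hxC) _ (Real.exp_pos _)]
      exact mul_le_mul_right (Finset.le_sup (f := fun b => W n (T a b x)) hb) _
    -- The obstacle vanishes because 1/m_n → 0, and a maximum over the finite set t commutes with
    -- the limit.
    have h2 : H x ≤ max (0 * height e x)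
        (expE (-l') * (expE (l' - l) * t.sup fun b => H (T a b x))) := by
      refine le_of_tendsto_of_tendsto' (hH x) (Tendsto.max ?_ ?_) h1
      · exact ENNReal.Tendsto.mul_const (hinv.mono_left Nat.hyperfilter_le_atTop)
          (Or.inr (height_ne_top x))
      · exact ENNReal.Tendsto.const_mul (ENNReal.Tendsto.const_mul
          (Tendsto.finset_sup_nhds_apply fun b _ => hH _) (Or.inr (expE_ne_top _)))
          (Or.inr (expE_ne_top _))
    obtain ⟨b, -, hb⟩ := t.exists_mem_eq_sup ht0 fun b => H (T a b x)
    refine ⟨b, ?_⟩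
    rw [zero_mul, max_eq_right zero_le, hb, ← mul_assoc, ← expE_add] at h2
    refine (mul_le_mul_right h2 _).trans_eq ?_
    rw [← mul_assoc, ← expE_add, show l + (-l' + (l' - l)) = 0 by ring, expE_zero, one_mul]

end Superharmonic

/-! ### Values, uniform values and stationary strategies -/

section UniformValue

variable {X A B : Type*} {d : X → X → ℝ} {T : A → B → X → X} {x₀ : X} {ρ : ℝ}

lemma escapeRate_le_of_eventually {σ : MinStrategy X A B} {τ : MaxStrategy X A B} {r : ℝ}
    (h : ∀ᶠ k : ℕ in atTop, payoff d T x₀ σ τ k / k ≤ r) :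
    escapeRate d T x₀ σ τ ≤ (r : EReal) :=
  limsup_le_of_le (h := h.mono fun _ hk => EReal.coe_le_coe_iff.2 hk)

lemma le_escapeRate_of_eventually {σ : MinStrategy X A B} {τ : MaxStrategy X A B} {r : ℝ}
    (h : ∀ᶠ k : ℕ in atTop, r ≤ payoff d T x₀ σ τ k / k) :
    (r : EReal) ≤ escapeRate d T x₀ σ τ :=
  (le_liminf_of_le (h := h.mono fun _ hk => EReal.coe_le_coe_iff.2 hk)).trans liminf_le_limsup

lemma IsUniformValue.isValue (h : IsUniformValue d T x₀ ρ) : IsValue d T x₀ ρ := by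
  intro ε hε
  obtain ⟨σ, τ, N, hN⟩ := h ε hε
  exact ⟨σ, τ,
    fun τ' => escapeRate_le_of_eventually (eventually_atTop.2 ⟨N, fun k hk => (hN k hk).1 τ'⟩),
    fun σ' => le_escapeRate_of_eventually (eventually_atTop.2 ⟨N, fun k hk => (hN k hk).2 σ'⟩)⟩

/-- Play a near-optimal strategy of Min for ρ against a near-optimal strategy of Max for r. -/
lemma IsValue.le {r : ℝ} (h : IsValue d T x₀ ρ) (h' : IsValue d T x₀ r) : r ≤ ρ := by
  refine le_of_forall_pos_le_add fun ε hε => ?_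
  obtain ⟨σ, -, hσ, -⟩ := h (ε / 2) (half_pos hε)
  obtain ⟨-, τ, -, hτ⟩ := h' (ε / 2) (half_pos hε)
  have := EReal.coe_le_coe_iff.1 ((hτ σ).trans (hσ τ))
  linarith

lemma IsValue.eq {r : ℝ} (h : IsValue d T x₀ ρ) (h' : IsValue d T x₀ r) : r = ρ :=
  le_antisymm (h.le h') (h'.le h)

/-- The additive constants do not depend on the opponent, so division by k makes them uniformly
negligible. -/
lemma isUniformValue_of_linear_bounds
    (hmin : ∀ l, ρ < l → ∃ (σ : MinStrategy X A B) (c : ℝ),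
      ∀ τ k, payoff d T x₀ σ τ k ≤ k * l + c)
    (hmax : ∀ l, l < ρ → ∃ (τ : MaxStrategy X A B) (c : ℝ),
      ∀ σ k, k * l - c ≤ payoff d T x₀ σ τ k) :
    IsUniformValue d T x₀ ρ := by
  intro ε hε
  obtain ⟨σ', c, hσ⟩ := hmin (ρ + ε / 2) (by linarith)
  obtain ⟨τ', c', hτ⟩ := hmax (ρ - ε / 2) (by linarith)
  obtain ⟨N, hN⟩ := exists_nat_gt (max (max c c' / (ε / 2)) 0)
  refine ⟨σ', τ', N, fun k hk => ?_⟩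
  have hNk : (N : ℝ) ≤ k := Nat.cast_le.2 hk
  have hk0 : (0 : ℝ) < k := ((le_max_right _ _).trans_lt hN).trans_le hNk
  have hck : max c c' ≤ k * (ε / 2) :=
    (div_le_iff₀ (half_pos hε)).1 (((le_max_left _ _).trans hN.le).trans hNk)
  have h1 := (le_max_left c c').trans hck
  have h2 := (le_max_right c c').trans hck
  refine ⟨fun τ => (div_le_iff₀ hk0).2 ((hσ τ k).trans ?_),
    fun σ => (le_div_iff₀ hk0).2 (le_trans ?_ (hτ σ k))⟩ <;> nlinarith

/-- A potential that decreases under a stationary strategy of the first player. -/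
lemma play_le_pow_mul {V : X → ENNReal} {c : ENNReal} {s : X → A}
    (h : ∀ x b, V (T (s x) b x) ≤ c * V x) (τ : MaxStrategy X A B) (k : ℕ) :
    V (play T x₀ (fun _ x => s x) τ k).2 ≤ c ^ k * V x₀ := by
  induction k with
  | zero => simp [play]
  | succ k ih =>
    refine (h _ _).trans ?_
    rw [pow_succ', mul_assoc]
    exact mul_le_mul_right ih _

/-- A potential that increases under a stationary strategy of the second player. -/
lemma pow_mul_le_play {V : X → ENNReal} {c : ENNReal} {s : X → A → B}
    (h : ∀ x a, c * V x ≤ V (T a (s x a) x)) (σ : MinStrategy X A B) (k : ℕ) :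
    c ^ k * V x₀ ≤ V (play T x₀ σ (fun _ x a => s x a) k).2 := by
  induction k with
  | zero => simp [play]
  | succ k ih =>
    refine le_trans ?_ (h _ _)
    rw [pow_succ', mul_assoc]
    exact mul_le_mul_right ih _

end UniformValue

/-! ### From potentials to strategies in the conical game -/

section ConicalGame

variable {E : Type*} [NormedAddCommGroup E] [InnerProductSpace ℝ E] {C : ProperCone ℝ E} {e : E}

lemma bddBelow_funkSet (x y : E) : BddBelow (funkSet C x y) := ⟨0, fun _ h => h.1.le⟩

variable [FiniteDimensional ℝ E] [Nontrivial E]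
  (he : e ∈ interior (ProperCone.innerDual (C : Set E) : Set E))

include he

lemma div_le_sInf_funkSet {x y : E} (hy : y ∈ interior (C : Set E))
    (hne : (funkSet C x y).Nonempty) : inner ℝ x e / inner ℝ y e ≤ sInf (funkSet C x y) := by
  refine le_csInf hne fun α hα => ?_
  have h := inner_nonneg_of_mem he hα.2
  rw [inner_sub_left, real_inner_smul_left] at h
  exact (div_le_iff₀ (inner_pos_of_mem_interior he hy)).2 (by linarith)

/-- The upper bound holds because y is an order unit, the lower one by pairing x ≤ α y with e. -/
lemma exists_funk_bounds {y : E} (hy : y ∈ interior (C : Set E)) :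
    ∃ c : ℝ, ∀ x ∈ interior (C : Set E),
      funk C x y ≤ Real.log (inner ℝ x e) + c ∧ Real.log (inner ℝ x e) - c ≤ funk C x y := by
  obtain ⟨K, hK, hdom⟩ := exists_dominates he hy
  have hypos := inner_pos_of_mem_interior he hy
  refine ⟨max (Real.log K) (Real.log (inner ℝ y e)), fun x hx => ?_⟩
  have hxpos := inner_pos_of_mem_interior he hx
  have hmem : K * inner ℝ x e ∈ funkSet C x y :=
    ⟨mul_pos hK hxpos, hdom x (interior_subset hx)⟩
  have hlow := div_le_sInf_funkSet he hy ⟨_, hmem⟩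
  have hpos : 0 < inner ℝ x e / inner ℝ y e := div_pos hxpos hypos
  constructor
  · have h := Real.log_le_log (hpos.trans_le hlow) (csInf_le (bddBelow_funkSet x y) hmem)
    rw [Real.log_mul hK.ne' hxpos.ne'] at h
    exact h.trans (by linarith [le_max_left (Real.log K) (Real.log (inner ℝ y e))])
  · have h := Real.log_le_log hpos hlow
    rw [Real.log_div hxpos.ne' hypos.ne'] at h
    exact le_trans (by linarith [le_max_right (Real.log K) (Real.log (inner ℝ y e))]) h

variable {A B : Type*} {T : A → B → interior (C : Set E) → interior (C : Set E)}
  {Tbar : A → B → E → E} (hext : ∀ a b (x : interior (C : Set E)), Tbar a b (x : E) = (T a b x : E))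

include hext

/-- Along the play, c h(x_k) ≤ V(x_k) ≤ e^{kl} V(x₀) ≤ e^{kl} h(x₀). -/
lemma exists_minStrategy {V : E → ENNReal} {c : ENNReal} {l l' : ℝ} (hl : l' < l)
    (hVle : ∀ x ∈ C, V x ≤ height e x) (hc : c ≠ 0) (hcV : ∀ x ∈ C, c * height e x ≤ V x)
    (hV : ∀ x ∈ C, conicShapley Tbar V x ≤ expE l' * V x) (x₀ : interior (C : Set E)) :
    ∃ (σ : MinStrategy (interior (C : Set E)) A B) (d : ℝ),
      ∀ τ k, payoff (fun x y : interior (C : Set E) => funk C x y) T x₀ σ τ k ≤ k * l + d := by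
  have hstep : ∀ x : interior (C : Set E), ∃ a, ∀ b, V (T a b x) ≤ expE l * V x := by
    intro x
    have hx : (x : E) ∈ C := interior_subset x.2
    have hV0 : V x ≠ 0 := by
      refine ((pos_iff_ne_zero.2 (mul_ne_zero hc ?_)).trans_le (hcV x hx)).ne'
      simpa [height] using inner_pos_of_mem_interior he x.2
    have hVtop : V x ≠ ⊤ := ne_top_of_le_ne_top (height_ne_top _) (hVle x hx)
    -- As V x is positive and finite, l' < l gives a strict inequality, so some action works without
    -- the infimum being attained.
    have hlt : conicShapley Tbar V x < expE l * V x :=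
      (hV x hx).trans_lt (ENNReal.mul_lt_mul_left hV0 hVtop (expE_lt.2 hl))
    obtain ⟨a, ha⟩ := iInf_lt_iff.1 hlt
    exact ⟨a, fun b => by rw [← hext]; exact (le_iSup _ b).trans ha.le⟩
  choose s hs using hstep
  obtain ⟨d, hd⟩ := exists_funk_bounds he x₀.2
  have hc1 : c ≠ ⊤ := by
    rintro rfl
    have h := (hcV x₀ (interior_subset x₀.2)).trans (hVle x₀ (interior_subset x₀.2))
    have hpos : height e (x₀ : E) ≠ 0 := by
      simpa [height] using inner_pos_of_mem_interior he x₀.2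
    rw [ENNReal.top_mul hpos] at h
    exact height_ne_top _ (top_le_iff.1 h)
  refine ⟨fun _ x => s x, -Real.log c.toReal + Real.log (inner ℝ (x₀ : E) e) + d,
    fun τ k => ?_⟩
  have hk := play_le_pow_mul (T := T) (V := fun x => V x) (x₀ := x₀) hs τ k
  set x := (play T x₀ (fun _ x => s x) τ k).2 with hx
  have hxC : (x : E) ∈ C := interior_subset x.2
  have h := ((hcV x hxC).trans hk).trans
    (mul_le_mul_right (hVle x₀ (interior_subset x₀.2)) _)
  rw [expE_pow] at h
  have h' := ENNReal.toReal_mono (ENNReal.mul_ne_top (expE_ne_top _) (height_ne_top _)) h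
  have hcpos := ENNReal.toReal_pos hc hc1
  have hxpos := inner_pos_of_mem_interior he x.2
  have hx₀pos := inner_pos_of_mem_interior he x₀.2
  rw [ENNReal.toReal_mul, ENNReal.toReal_mul, height, height, expE,
    ENNReal.toReal_ofReal hxpos.le, ENNReal.toReal_ofReal hx₀pos.le,
    ENNReal.toReal_ofReal (Real.exp_pos _).le] at h'
  have h2 := Real.log_le_log (mul_pos hcpos hxpos) h'
  rw [Real.log_mul hcpos.ne' hxpos.ne', Real.log_mul (Real.exp_pos _).ne' hx₀pos.ne',
    Real.log_exp] at h2
  exact (hd x x.2).1.trans (by linarith)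

/-- Along the play, e^{kl} H(x₀) ≤ H(x_k) ≤ h(x_k); positivity of H matters only at x₀. -/
lemma exists_maxStrategy {H : E → ENNReal} {l : ℝ}
    (hH : ∀ x ∈ interior (C : Set E), H x ≠ 0 ∧ H x ≤ height e x)
    (hstep : ∀ x ∈ interior (C : Set E), ∀ a, ∃ b, expE l * H x ≤ H (Tbar a b x))
    (x₀ : interior (C : Set E)) :
    ∃ (τ : MaxStrategy (interior (C : Set E)) A B) (d : ℝ),
      ∀ σ k, k * l - d ≤ payoff (fun x y : interior (C : Set E) => funk C x y) T x₀ σ τ k := by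
  have hstep' : ∀ (x : interior (C : Set E)) (a : A), ∃ b, expE l * H x ≤ H (T a b x) := by
    intro x a
    obtain ⟨b, hb⟩ := hstep x x.2 a
    exact ⟨b, by rwa [← hext]⟩
  choose s hs using hstep'
  obtain ⟨d, hd⟩ := exists_funk_bounds he x₀.2
  obtain ⟨hH0, hH1⟩ := hH x₀ x₀.2
  refine ⟨fun _ x a => s x a, -Real.log (H x₀).toReal + d, fun σ k => ?_⟩
  have hk := pow_mul_le_play (T := T) (V := fun x => H x) (x₀ := x₀) hs σ k
  set x := (play T x₀ σ (fun _ x a => s x a) k).2 with hx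
  have h := hk.trans (hH x x.2).2
  rw [expE_pow] at h
  have h' := ENNReal.toReal_mono (height_ne_top _) h
  have hpos := ENNReal.toReal_pos hH0 (ne_top_of_le_ne_top (height_ne_top _) hH1)
  have hxpos := inner_pos_of_mem_interior he x.2
  rw [ENNReal.toReal_mul, height, expE, ENNReal.toReal_ofReal hxpos.le,
    ENNReal.toReal_ofReal (Real.exp_pos _).le] at h'
  have h2 := Real.log_le_log (mul_pos (Real.exp_pos _) hpos) h'
  rw [Real.log_mul (Real.exp_pos _).ne' hpos.ne', Real.log_exp] at h2
  exact le_trans (by linarith) (hd x x.2).2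

end ConicalGame

/-! ### Back to the normalized Shapley operator -/

section LogarithmicForm

variable {E : Type*} [NormedAddCommGroup E] [InnerProductSpace ℝ E] [FiniteDimensional ℝ E]
  {A B : Type*} {C : ProperCone ℝ E} {e : E} {T : A → B → E → E} {V : E → ENNReal}

lemma log_expE (t : ℝ) : ENNReal.log (expE t) = (t : EReal) := by
  rw [expE, ENNReal.log_ofReal_of_pos (Real.exp_pos t), Real.log_exp]

variable (he : e ∈ interior (ProperCone.innerDual (C : Set E) : Set E)) (hT : IsConicFamily C T)

include he

/-- This is homogeneity of V in logarithmic form; at y = 0 both sides are -∞. -/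
lemma log_height_add (hV : IsConicFun C V) {v : E → EReal}
    (hv : ∀ x ∈ crossSection C e, v x = ENNReal.log (V x)) {y : E} (hy : y ∈ C) :
    ENNReal.log (ENNReal.ofReal (inner ℝ y e)) + v ((inner ℝ y e)⁻¹ • y) =
      ENNReal.log (V y) := by
  rcases eq_or_ne y 0 with rfl | hy0
  · simp [hV.zero]
  have hpos := inner_pos_of_mem he hy hy0
  rw [hv _ (inv_inner_smul_mem_crossSection hy hpos), ← ENNReal.log_mul_add,
    hV.smul y hy _ (inv_pos.2 hpos), ← mul_assoc, ← ENNReal.ofReal_mul hpos.le,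
    mul_inv_cancel₀ hpos.ne', ENNReal.ofReal_one, one_mul]

include hT

/-- The logarithm is an order isomorphism from [0, ∞] to `EReal`, so it commutes with infima and
suprema. -/
lemma shapley_eq_log (hV : IsConicFun C V) {v : E → EReal}
    (hv : ∀ x ∈ crossSection C e, v x = ENNReal.log (V x)) {x : E} (hx : x ∈ C) :
    shapley T e v x = ENNReal.log (conicShapley T V x) := by
  have h : ENNReal.log (conicShapley T V x) = ⨅ a, ⨆ b, ENNReal.log (V (T a b x)) := by
    simp only [conicShapley, ← ENNReal.logOrderIso_apply, OrderIso.map_iInf, OrderIso.map_iSup]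
  rw [h]
  exact iInf_congr fun a => iSup_congr fun b => log_height_add he hV hv (hT.mem a b x hx)

lemma shapley_iterate_eq_log [Nonempty A] (k : ℕ) {x : E} (hx : x ∈ crossSection C e) :
    (shapley T e)^[k] 0 x = ENNReal.log ((conicShapley T)^[k] (height e) x) := by
  induction k generalizing x with
  | zero => simp [height_eq_one hx]
  | succ k ih =>
    rw [Function.iterate_succ_apply', Function.iterate_succ_apply']
    exact shapley_eq_log he hT ((isConicFun_height he).conicShapley_iterate hT k)
      (fun y hy => ih hy) hx.1

lemma delta_shapley_iterate [Nonempty A] (k : ℕ) :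
    delta C e ((shapley T e)^[k] 0) 0 = ENNReal.log (growth C e T k) := by
  have h : ENNReal.log (growth C e T k) =
      ⨆ x ∈ crossSection C e, ENNReal.log ((conicShapley T)^[k] (height e) x) := by
    simp only [growth, ← ENNReal.logOrderIso_apply, OrderIso.map_iSup]
  rw [h, delta]
  refine iSup_congr fun x => iSup_congr fun hx => ?_
  rw [shapley_iterate_eq_log he hT k hx, Pi.zero_apply, sub_zero]

end LogarithmicForm

/-! ### Correspondence between `CLip` and positive conic functions -/

section HomogeneousExtension

variable {E : Type*} [NormedAddCommGroup E] [InnerProductSpace ℝ E]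
  {C : ProperCone ℝ E} {e : E} {v : E → ℝ}

/-- The positively homogeneous function on the cone with logarithm `v` on the cross section. -/
def homExtension (e : E) (v : E → ℝ) (x : E) : ENNReal :=
  height e x * expE (v ((inner ℝ x e)⁻¹ • x))

lemma homExtension_eq {x : E} (hx : x ∈ crossSection C e) : homExtension e v x = expE (v x) := by
  rw [homExtension, height_eq_one hx, hx.2, inv_one, one_smul, one_mul]

/-- The logarithm of a positive continuous conic function belongs to `CLip`. -/
lemma log_toReal_mem_CLip {V : E → ENNReal} (hV : IsConicFun C V)
    (hcont : ContinuousOn V (C : Set E)) (h0 : ∀ x ∈ crossSection C e, V x ≠ 0)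
    (htop : ∀ x ∈ crossSection C e, V x ≠ ⊤) :
    (fun x => Real.log (V x).toReal) ∈ CLip C e := by
  have hpos : ∀ x ∈ crossSection C e, 0 < (V x).toReal :=
    fun x hx => ENNReal.toReal_pos (h0 x hx) (htop x hx)
  refine ⟨fun x hx => ?_, fun x hx y hy hne => ?_⟩
  · have h : ContinuousWithinAt (fun y => (V y).toReal) (crossSection C e) x :=
      (ENNReal.continuousAt_toReal (htop x hx)).comp_continuousWithinAt
        ((hcont x hx.1).mono fun y hy => hy.1)
    exact h.log (hpos x hx).ne'
  · rw [← Real.log_div (hpos x hx).ne' (hpos y hy).ne']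
    refine Real.log_le_log (div_pos (hpos x hx) (hpos y hy)) (le_csInf hne fun α hα => ?_)
    rw [div_le_iff₀ (hpos y hy)]
    have h := hV.mono x hx.1 _ hα.2
    rw [hV.smul y hy.1 α hα.1] at h
    have h' := ENNReal.toReal_mono (ENNReal.mul_ne_top ENNReal.ofReal_ne_top (htop y hy)) h
    rwa [ENNReal.toReal_mul, ENNReal.toReal_ofReal hα.1.le] at h'

variable [FiniteDimensional ℝ E]
  (he : e ∈ interior (ProperCone.innerDual (C : Set E) : Set E))

include he

lemma one_le_sInf_funkSet {x y : E} (hx : x ∈ crossSection C e) (hy : y ∈ crossSection C e)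
    (hne : (funkSet C x y).Nonempty) : 1 ≤ sInf (funkSet C x y) := by
  refine le_csInf hne fun α hα => ?_
  have h := inner_nonneg_of_mem he hα.2
  rw [inner_sub_left, real_inner_smul_left, hx.2, hy.2] at h
  linarith

/-- If x ≤ y, the normalized points satisfy x' ≤ (⟨y,e⟩/⟨x,e⟩) y', so v(x') - v(y') ≤ log⟨y,e⟩ -
log⟨x,e⟩, which is monotonicity. -/
lemma isConicFun_homExtension (hv : v ∈ CLip C e) : IsConicFun C (homExtension e v) where
  zero := by simp [homExtension, height]
  smul x hx c hc := by
    rw [homExtension, (isConicFun_height he).smul x hx c hc, homExtension, mul_assoc]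
    congr 4
    rw [real_inner_smul_left, smul_smul, mul_inv, mul_right_comm, inv_mul_cancel₀ hc.ne', one_mul]
  mono x hx y hxy := by
    rcases eq_or_ne x 0 with rfl | hx0
    · simp [homExtension, height]
    have hxpos := inner_pos_of_mem he hx hx0
    have hle := inner_nonneg_of_mem he hxy
    rw [inner_sub_left] at hle
    have hypos : 0 < inner ℝ y e := by linarith
    have hx' := inv_inner_smul_mem_crossSection hx hxpos
    have hy' := inv_inner_smul_mem_crossSection (cone_mem_of_sub_mem hx hxy) hypos
    have hmem : inner ℝ y e / inner ℝ x e ∈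
        funkSet C ((inner ℝ x e)⁻¹ • x) ((inner ℝ y e)⁻¹ • y) := by
      refine ⟨div_pos hypos hxpos, ?_⟩
      have h := cone_smul_mem hxy (inv_nonneg.2 hxpos.le)
      rw [smul_sub] at h
      rwa [smul_smul, div_mul_eq_mul_div, mul_inv_cancel₀ hypos.ne', one_div]
    have h1 := hv.2 _ hx' _ hy' ⟨_, hmem⟩
    have h2 : funk C ((inner ℝ x e)⁻¹ • x) ((inner ℝ y e)⁻¹ • y) ≤
        Real.log (inner ℝ y e / inner ℝ x e) :=
      Real.log_le_log (one_pos.trans_le (one_le_sInf_funkSet he hx' hy' ⟨_, hmem⟩))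
        (csInf_le (bddBelow_funkSet _ _) hmem)
    rw [Real.log_div hypos.ne' hxpos.ne'] at h2
    have hh : ∀ z : E, 0 < inner ℝ z e → height e z = expE (Real.log (inner ℝ z e)) :=
      fun z hz => by rw [height, expE, Real.exp_log hz]
    rw [homExtension, homExtension, hh x hxpos, hh y hypos, ← expE_add, ← expE_add, expE_le]
    linarith

lemma exists_homExtension_bounds (hv : v ∈ CLip C e) :
    ∃ R : ℝ, ∀ x ∈ C, homExtension e v x ≤ expE R * height e x ∧
      height e x ≤ expE R * homExtension e v x := by
  obtain ⟨R, hR⟩ := (isCompact_crossSection he).exists_bound_of_continuousOn hv.1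
  refine ⟨R, fun x hx => ?_⟩
  rcases eq_or_ne x 0 with rfl | hx0
  · simp [homExtension, height]
  have h := abs_le.1 (hR _ (inv_inner_smul_mem_crossSection hx (inner_pos_of_mem he hx hx0)))
  constructor
  · rw [homExtension, mul_comm]
    exact mul_le_mul_left (expE_le.2 h.2) _
  · rw [homExtension, mul_left_comm, ← expE_add]
    refine le_mul_of_one_le_right' ?_
    rw [← expE_zero, expE_le]
    linarith [h.1]

lemma continuousOn_homExtension (hv : v ∈ CLip C e) :
    ContinuousOn (homExtension e v) (C : Set E) := by
  intro x hx
  rcases eq_or_ne x 0 with rfl | hx0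
  -- The normalization is singular at 0; there the extension is squeezed between 0 and a multiple of
  -- `height`.
  · obtain ⟨R, hR⟩ := exists_homExtension_bounds he hv
    have h0 : Tendsto (fun y => expE R * height e y) (𝓝[(C : Set E)] 0) (𝓝 0) := by
      have h := ((ENNReal.continuous_const_mul (expE_ne_top R)).comp
        (continuous_height (e := e))).tendsto 0
      have hz : height e (0 : E) = 0 := by simp [height]
      simp only [Function.comp_def, hz, mul_zero] at h
      exact h.mono_left nhdsWithin_le_nhds
    rw [ContinuousWithinAt, (isConicFun_homExtension he hv).zero]
    exact tendsto_of_tendsto_of_tendsto_of_le_of_le' tendsto_const_nhds h0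
      (Eventually.of_forall fun _ => zero_le)
      (eventually_mem_nhdsWithin.mono fun y hy => (hR y hy).1)
  · have hpos := inner_pos_of_mem he hx hx0
    have hinner : Continuous fun y : E => inner ℝ y e := continuous_id.inner continuous_const
    have hU : {y : E | 0 < inner ℝ y e} ∈ 𝓝 x :=
      (isOpen_lt continuous_const hinner).mem_nhds hpos
    rw [← continuousWithinAt_inter hU]
    have hnorm : ContinuousWithinAt (fun y : E => (inner ℝ y e)⁻¹ • y)
        ((C : Set E) ∩ {y : E | 0 < inner ℝ y e}) x :=
      ((hinner.continuousAt.inv₀ hpos.ne').smul continuousAt_id).continuousWithinAt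
    have hv' : ContinuousWithinAt (fun y : E => v ((inner ℝ y e)⁻¹ • y))
        ((C : Set E) ∩ {y : E | 0 < inner ℝ y e}) x :=
      ContinuousWithinAt.comp (g := v) (t := crossSection C e)
        (hv.1 _ (inv_inner_smul_mem_crossSection hx hpos)) hnorm
        fun y hy => inv_inner_smul_mem_crossSection hy.1 hy.2
    refine ENNReal.Tendsto.mul continuous_height.continuousWithinAt (Or.inr (expE_ne_top _))
      ?_ (Or.inr (height_ne_top _))
    exact (ENNReal.continuous_ofReal.comp Real.continuous_exp).continuousAt.comp_continuousWithinAt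
      hv'

variable {A B : Type*} {T : A → B → E → E} (hT : IsConicFamily C T)

include hT

lemma shapley_eq_log_homExtension (hv : v ∈ CLip C e) {x : E} (hx : x ∈ crossSection C e) :
    shapley T e (fun y => (v y : EReal)) x =
      ENNReal.log (conicShapley T (homExtension e v) x) :=
  shapley_eq_log he hT (isConicFun_homExtension he hv)
    (fun y hy => by rw [homExtension_eq hy, log_expE]) hx.1

lemma shapley_sub_eq_log (hv : v ∈ CLip C e) {x : E} (hx : x ∈ crossSection C e) :
    shapley T e (fun y => (v y : EReal)) x - (v x : EReal) =
      ENNReal.log (expE (-v x) * conicShapley T (homExtension e v) x) := by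
  rw [shapley_eq_log_homExtension he hT hv hx, ENNReal.log_mul_add, log_expE, EReal.coe_neg,
    sub_eq_add_neg, add_comm]

variable [Nonempty A]

lemma conicShapley_homExtension_le (hv : v ∈ CLip C e) {l : ℝ}
    (h : ∀ x ∈ crossSection C e,
      shapley T e (fun y => (v y : EReal)) x ≤ ((l + v x : ℝ) : EReal)) :
    ∀ x ∈ C, conicShapley T (homExtension e v) x ≤ expE l * homExtension e v x := by
  have hV := isConicFun_homExtension he hv
  intro x hx
  rcases eq_or_ne x 0 with rfl | hx0
  · simp [(hV.conicShapley hT).zero]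
  have hpos := inner_pos_of_mem he hx hx0
  have hx' := inv_inner_smul_mem_crossSection hx hpos
  have h1 := h _ hx'
  rw [shapley_eq_log_homExtension he hT hv hx', ← log_expE, ENNReal.log_le_log_iff, expE_add,
    ← homExtension_eq hx', (hV.conicShapley hT).smul x hx _ (inv_pos.2 hpos),
    hV.smul x hx _ (inv_pos.2 hpos), mul_left_comm] at h1
  exact (ENNReal.mul_le_mul_iff_right (by simpa using hpos) ENNReal.ofReal_ne_top).1 h1

variable [TopologicalSpace A] [TopologicalSpace B] [CompactSpace A] [CompactSpace B]
  [Nonempty B] [Nontrivial E] (hint : (interior (C : Set E)).Nonempty)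
  (hcont : ContinuousOn (fun p : A × B × E => T p.1 p.2.1 p.2.2)
      (univ ×ˢ (univ ×ˢ (C : Set E))))

include hint hcont

/-- The extension V of v is comparable to h within e^R and ΦV ≤ e^l V, so g_k ≤ e^{2R + kl}; compare
with kρ for large k. -/
lemma le_of_shapley_le {ρ l : ℝ} (hρ : ∀ k : ℕ, k * ρ ≤ logGrowth C e T k) (hv : v ∈ CLip C e)
    (h : ∀ x ∈ crossSection C e,
      shapley T e (fun y => (v y : EReal)) x ≤ ((l + v x : ℝ) : EReal)) : ρ ≤ l := by
  obtain ⟨R, hR⟩ := exists_homExtension_bounds he hv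
  have hΦ := conicShapley_homExtension_le he hT hv h
  have hle : ∀ k : ℕ, k * ρ ≤ R + k * l + R := by
    intro k
    have h1 : growth C e T k ≤ expE (R + k * l + R) := growth_le_of_le fun x hx => by
      refine (conicShapley_iterate_mono hT (fun y hy => (hR y hy).2) k x hx).trans ?_
      rw [conicShapley_iterate_const_mul (expE_ne_zero _) (expE_ne_top _), expE_add, expE_add,
        mul_assoc, mul_assoc, ← expE_pow]
      refine mul_le_mul_right ((conicShapley_iterate_le_pow_mul hT (expE_ne_zero _)
        (expE_ne_top _) hΦ k x hx).trans (mul_le_mul_right (hR x hx).1 _)) _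
    rw [growth_eq he hT hint hcont] at h1
    exact (hρ k).trans (expE_le.1 h1)
  by_contra! hlt
  obtain ⟨k, hk⟩ := exists_nat_gt (2 * R / (ρ - l))
  rw [div_lt_iff₀ (sub_pos.2 hlt)] at hk
  linarith [hle k]

/-- exp(Fv - v) is continuous from the compact Δ to [0, ∞]. Its maximum is finite, and nonzero
because it is positive at an interior point, so its logarithm is real even if Fv = -∞ somewhere on
the boundary. -/
lemma exists_isGreatest_shapley_sub (hv : v ∈ CLip C e) :
    ∃ m : ℝ, IsGreatest ((fun x => shapley T e (fun y => (v y : EReal)) x - (v x : EReal)) ''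
      crossSection C e) (m : EReal) := by
  have hV := isConicFun_homExtension he hv
  set g : E → ENNReal := fun x => expE (-v x) * conicShapley T (homExtension e v) x with hg
  obtain ⟨u, hu⟩ := hint
  have hu' := inv_inner_smul_mem_crossSection (interior_subset hu)
    (inner_pos_of_mem_interior he hu)
  have hgcont : ContinuousOn g (crossSection C e) := fun x hx => by
    refine ENNReal.Tendsto.mul ?_ (Or.inl (expE_ne_zero _))
      ((continuousOn_conicShapley hT hcont (continuousOn_homExtension he hv) x hx.1).mono
        fun y hy => hy.1) (Or.inr (expE_ne_top _))
    exact (ENNReal.continuous_ofReal.comp Real.continuous_exp).continuousAt.comp_continuousWithinAt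
      (hv.1 x hx).neg
  obtain ⟨z, hz, hmax⟩ := (isCompact_crossSection he).exists_isMaxOn ⟨_, hu'⟩ hgcont
  have hgtop : g z ≠ ⊤ := by
    obtain ⟨R, hR⟩ := exists_homExtension_bounds he hv
    have h1 := conicShapley_mono hT (fun y hy => (hR y hy).1) z hz.1
    rw [conicShapley_const_mul (expE_ne_zero _) (expE_ne_top _)] at h1
    have h2 := iterate_height_le_growth_mul he hT 1 hz.1
    rw [height_eq_one hz, mul_one] at h2
    refine ENNReal.mul_ne_top (expE_ne_top _) (ne_top_of_le_ne_top
      (ENNReal.mul_ne_top (expE_ne_top _) (ne_top_of_le_ne_top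
        (growth_ne_top he hT ⟨u, hu⟩ hcont 1) h2)) h1)
  have hg0 : g z ≠ 0 := by
    have hui := smul_mem_interior hu (inv_pos.2 (inner_pos_of_mem_interior he hu))
    obtain ⟨μ, hμ, h⟩ := exists_smul_le_apply hT hcont hui
    have h1 := le_conicShapley hu'.1 hμ h hV
    rw [homExtension_eq hu'] at h1
    have h2 : conicShapley T (homExtension e v) ((inner ℝ u e)⁻¹ • u) ≠ 0 :=
      ((pos_iff_ne_zero.2 (mul_ne_zero (by simpa using hμ) (expE_ne_zero _))).trans_le h1).ne'
    exact ((pos_iff_ne_zero.2 (mul_ne_zero (expE_ne_zero _) h2)).trans_le (hmax hu')).ne'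
  refine ⟨Real.log (g z).toReal, ?_⟩
  rw [← ENNReal.log_pos_real hg0 hgtop]
  refine ⟨⟨z, hz, shapley_sub_eq_log he hT hv hz⟩, ?_⟩
  rintro _ ⟨x, hx, rfl⟩
  dsimp only
  rw [shapley_sub_eq_log he hT hv hx]
  exact ENNReal.log_monotone (hmax hx)

end HomogeneousExtension

/-! ### Order and homogeneity of the extension to the closed cone -/

section Extension

variable {E : Type*} [NormedAddCommGroup E] [InnerProductSpace ℝ E] {C : ProperCone ℝ E}
  {A B : Type*} {T : A → B → interior (C : Set E) → interior (C : Set E)} {Tbar : A → B → E → E}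

/-- The continuous extension to the cone of a family of order-preserving and homogeneous self-maps
of the interior inherits these properties. -/
lemma isConicFamily_of_extension [TopologicalSpace A] [TopologicalSpace B]
    (hint : (interior (C : Set E)).Nonempty)
    (hmono : ∀ a b (x y : interior (C : Set E)),
      (y : E) - (x : E) ∈ C → (T a b y : E) - (T a b x : E) ∈ C)
    (hhom : ∀ a b (c : ℝ) (x y : interior (C : Set E)), 0 < c →
      (y : E) = c • (x : E) → (T a b y : E) = c • (T a b x : E))
    (hext : ∀ a b (x : interior (C : Set E)), Tbar a b (x : E) = (T a b x : E))
    (hmaps : ∀ a b, MapsTo (Tbar a b) (C : Set E) (C : Set E))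
    (hcont : ContinuousOn (fun p : A × B × E => Tbar p.1 p.2.1 p.2.2)
      (univ ×ˢ (univ ×ˢ (C : Set E)))) : IsConicFamily C Tbar := by
  obtain ⟨u, hu⟩ := hint
  -- Points of C are approached by the interior points x + t u; a common shift preserves the order.
  have hin : ∀ x ∈ C, ∀ t : ℝ, 0 < t → x + t • u ∈ interior (C : Set E) :=
    fun x hx t ht => add_mem_interior hx (smul_mem_interior hu ht)
  have hcont' : ∀ a b, ContinuousOn (Tbar a b) (C : Set E) := fun a b =>
    hcont.comp (f := fun x : E => (a, b, x)) (by fun_prop)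
      fun x hx => ⟨mem_univ _, mem_univ _, hx⟩
  have hlim : ∀ a b, ∀ x ∈ C, Tendsto (fun t : ℝ => Tbar a b (x + t • u)) (𝓝[>] 0)
      (𝓝 (Tbar a b x)) := by
    intro a b x hx
    have h1 : Tendsto (fun t : ℝ => x + t • u) (𝓝[>] 0) (𝓝 x) := by
      have h : Continuous fun t : ℝ => x + t • u := by fun_prop
      simpa using (h.tendsto 0).mono_left nhdsWithin_le_nhds
    refine Tendsto.comp (hcont' a b x hx) (tendsto_nhdsWithin_iff.2 ⟨h1, ?_⟩)
    filter_upwards [self_mem_nhdsWithin] with t ht using interior_subset (hin x hx t ht)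
  refine ⟨fun a b x hx => hmaps a b hx, fun a b x hx => ?_, fun a b x hx y hxy => ?_,
    fun a b x hx c hc => ?_⟩
  · rw [hext a b ⟨x, hx⟩]
    exact (T a b ⟨x, hx⟩).2
  · have hy := cone_mem_of_sub_mem hx hxy
    refine C.isClosed.mem_of_tendsto ((hlim a b y hy).sub (hlim a b x hx)) ?_
    filter_upwards [self_mem_nhdsWithin] with t ht
    rw [hext a b ⟨_, hin x hx t ht⟩, hext a b ⟨_, hin y hy t ht⟩]
    exact hmono a b _ _ (by simpa using hxy)
  · have hcx := cone_smul_mem hx hc.le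
    have h1 : Tendsto (fun t : ℝ => c * t) (𝓝[>] 0) (𝓝[>] 0) := by
      refine tendsto_nhdsWithin_iff.2 ⟨?_, ?_⟩
      · have h : Continuous fun t : ℝ => c * t := by fun_prop
        simpa using (h.tendsto 0).mono_left nhdsWithin_le_nhds
      · filter_upwards [self_mem_nhdsWithin] with t ht using mul_pos hc ht
    -- Since c (x + t u) = c x + (c t) u, the parameter is rescaled to c t.
    refine tendsto_nhds_unique ((hlim a b _ hcx).comp h1)
      (((hlim a b x hx).const_smul c).congr' ?_)
    filter_upwards [self_mem_nhdsWithin] with t ht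
    rw [Function.comp_apply, hext a b ⟨_, hin x hx t ht⟩,
      hext a b ⟨_, hin _ hcx _ (mul_pos hc ht)⟩]
    exact (hhom a b c _ _ hc (by rw [smul_add, smul_smul])).symm

end Extension

end EscapeRate

end

/-! ### The main theorem -/

theorem mainTheorem4
    {E : Type*} [NormedAddCommGroup E] [InnerProductSpace ℝ E] [FiniteDimensional ℝ E]
    [Nontrivial E]
    {A B : Type*} [TopologicalSpace A] [CompactSpace A] [Nonempty A]
    [TopologicalSpace B] [CompactSpace B] [Nonempty B]
    -- a closed convex cone that is pointed and has nonempty interior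
    (C : ProperCone ℝ E)
    (hpointed : ∀ x : E, x ∈ C → -x ∈ C → x = 0)
    (hinterior : (interior (C : Set E)).Nonempty)
    -- a point in the interior of the dual cone
    (e : E) (he : e ∈ interior (ProperCone.innerDual (C : Set E) : Set E))
    -- order-preserving, positively homogeneous self-maps of the interior of the cone
    (T : A → B → interior (C : Set E) → interior (C : Set E))
    (hmono : ∀ a b (x y : interior (C : Set E)),
      (y : E) - (x : E) ∈ C → (T a b y : E) - (T a b x : E) ∈ C)
    (hhom : ∀ a b (c : ℝ) (x y : interior (C : Set E)), 0 < c →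
      (y : E) = c • (x : E) → (T a b y : E) = c • (T a b x : E))
    -- their extension to the closed cone, jointly continuous in `(a, b, x)`
    (Tbar : A → B → E → E)
    (hext : ∀ a b (x : interior (C : Set E)), Tbar a b (x : E) = (T a b x : E))
    (hmaps : ∀ a b, MapsTo (Tbar a b) (C : Set E) (C : Set E))
    (hcont : ContinuousOn (fun p : A × B × E => Tbar p.1 p.2.1 p.2.2)
      (univ ×ˢ (univ ×ˢ (C : Set E)))) :
    ∃ ρ : ℝ,
      -- `ρ` is the value of the game, for every initial state
      (∀ x₀ : interior (C : Set E),
        (∀ r : ℝ, IsUniformValue (fun x y : interior (C : Set E) => funk C x y) T x₀ r ↔ r = ρ) ∧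
        (∀ r : ℝ, IsValue (fun x y : interior (C : Set E) => funk C x y) T x₀ r ↔ r = ρ)) ∧
      -- `ρ = lim δ(F^k 0, 0) / k`
      Tendsto (fun k : ℕ => delta C e ((shapley Tbar e)^[k] 0) 0 / (k : EReal)) atTop
        (𝓝 (ρ : EReal)) ∧
      -- `ρ = inf_v max_Δ (F v - v)`, where the maxima are attained and finite
      (∀ v ∈ CLip C e, ∃ m : ℝ, IsGreatest
        ((fun x => shapley Tbar e (fun y => (v y : EReal)) x - (v x : EReal)) ''
          crossSection C e) (m : EReal)) ∧
      IsGLB {m : ℝ | ∃ v ∈ CLip C e, IsGreatest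
        ((fun x => shapley Tbar e (fun y => (v y : EReal)) x - (v x : EReal)) ''
          crossSection C e) (m : EReal)} ρ ∧
      -- `ρ = inf {l | ∃ v, F v ≤ l + v}`
      IsGLB {l : ℝ | ∃ v ∈ CLip C e, ∀ x ∈ crossSection C e,
        shapley Tbar e (fun y => (v y : EReal)) x ≤ ((l + v x : ℝ) : EReal)} ρ := by
  have hT : IsConicFamily C Tbar :=
    isConicFamily_of_extension hinterior hmono hhom hext hmaps hcont
  obtain ⟨ρ, hlim, hρ⟩ := exists_growthRate he hT hinterior hcont
  -- subsolutions above `ρ`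
  have hsub : ∀ l, ρ < l → ∃ V : E → ENNReal, IsConicFun C V ∧ ContinuousOn V (C : Set E) ∧
      (∀ x ∈ C, V x ≤ height e x) ∧
      (∃ c : ENNReal, c ≠ 0 ∧ ∀ x ∈ C, c * height e x ≤ V x) ∧
      ∀ x ∈ C, conicShapley Tbar V x ≤ expE l * V x := by
    intro l hl
    obtain ⟨k, hkl, hk⟩ := ((hlim.eventually_lt_const hl).and (eventually_gt_atTop 0)).exists
    refine exists_subsolution he hT hinterior hcont hk ?_
    rw [growth_eq he hT hinterior hcont]
    exact expE_lt.2 ((div_lt_iff₀' (Nat.cast_pos.2 hk)).1 hkl)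
  have hsub' : ∀ l, ρ < l → ∃ v ∈ CLip C e, ∀ x ∈ crossSection C e,
      shapley Tbar e (fun y => (v y : EReal)) x ≤ ((l + v x : ℝ) : EReal) := by
    intro l hl
    obtain ⟨V, hV, hVcont, hVle, ⟨c, hc, hcV⟩, hΦ⟩ := hsub l hl
    have h0 : ∀ x ∈ crossSection C e, V x ≠ 0 := fun x hx =>
      ((pos_iff_ne_zero.2 hc).trans_le (by simpa [height_eq_one hx] using hcV x hx.1)).ne'
    have htop : ∀ x ∈ crossSection C e, V x ≠ ⊤ := fun x hx =>
      ne_top_of_le_ne_top (height_ne_top x) (hVle x hx.1)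
    refine ⟨_, log_toReal_mem_CLip hV hVcont h0 htop, fun x hx => ?_⟩
    rw [shapley_eq_log he hT hV (fun y hy => (ENNReal.log_pos_real (h0 y hy) (htop y hy)).symm)
      hx.1, EReal.coe_add, ← ENNReal.log_pos_real (h0 x hx) (htop x hx), ← log_expE,
      ← ENNReal.log_mul_add]
    exact ENNReal.log_monotone (hΦ x hx.1)
  have hvalue : ∀ x₀ : interior (C : Set E),
      IsUniformValue (fun x y : interior (C : Set E) => funk C x y) T x₀ ρ := by
    intro x₀
    refine isUniformValue_of_linear_bounds (fun l hl => ?_) (fun l hl => ?_)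
    · obtain ⟨l', hl', hl'l⟩ := exists_between hl
      obtain ⟨V, -, -, hVle, ⟨c, hc, hcV⟩, hΦ⟩ := hsub l' hl'
      exact exists_minStrategy he hext hl'l hVle hc hcV hΦ x₀
    · obtain ⟨H, hH, hstep⟩ := exists_superharmonic he hT hinterior hcont hρ hl
      exact exists_maxStrategy he hext hH hstep x₀
  have hmax : ∀ v ∈ CLip C e, ∃ m : ℝ, IsGreatest
      ((fun x => shapley Tbar e (fun y => (v y : EReal)) x - (v x : EReal)) ''
        crossSection C e) (m : EReal) := fun v hv =>
    exists_isGreatest_shapley_sub he hT hinterior hcont hv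
  refine ⟨ρ, fun x₀ => ⟨fun r => ⟨fun h => (hvalue x₀).isValue.eq h.isValue, ?_⟩,
    fun r => ⟨fun h => (hvalue x₀).isValue.eq h, ?_⟩⟩, ?_, hmax, ⟨?_, ?_⟩, ⟨?_, ?_⟩⟩
  · rintro rfl
    exact hvalue x₀
  · rintro rfl
    exact (hvalue x₀).isValue
  · refine ((continuous_coe_real_ereal.tendsto ρ).comp hlim).congr fun k => ?_
    rw [delta_shapley_iterate he hT, growth_eq he hT hinterior hcont, ← expE, log_expE,
      Function.comp_apply, EReal.coe_div]
    rfl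
  · rintro m ⟨v, hv, hm⟩
    refine le_of_shapley_le he hT hinterior hcont hρ hv fun x hx => ?_
    have h := hm.2 (mem_image_of_mem _ hx)
    rwa [EReal.sub_le_iff_le_add (Or.inl (EReal.coe_ne_bot _)) (Or.inl (EReal.coe_ne_top _)),
      ← EReal.coe_add] at h
  · intro b hb
    -- For l > ρ, a function v with Fv ≤ l + v has max (Fv - v) ≤ l.
    refine le_of_forall_gt_imp_ge_of_dense fun l hl => ?_
    obtain ⟨v, hv, hle⟩ := hsub' l hl
    obtain ⟨m, hm⟩ := hmax v hv
    refine (hb ⟨v, hv, hm⟩).trans ?_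
    obtain ⟨x, hx, hxm⟩ := hm.1
    rw [← EReal.coe_le_coe_iff, ← hxm]
    dsimp only
    rw [EReal.sub_le_iff_le_add (Or.inl (EReal.coe_ne_bot _)) (Or.inl (EReal.coe_ne_top _)),
      ← EReal.coe_add]
    exact hle x hx
  · rintro l ⟨v, hv, hle⟩
    exact le_of_shapley_le he hT hinterior hcont hρ hv hle
  · intro b hb
    exact le_of_forall_gt_imp_ge_of_dense fun l hl => hb (hsub' l hl)
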